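/- Let $n\ge 2$, let $\Omega\subset\mathbb R^n$ be a bounded domain, $\epsilon>0$, and let $\alpha\ge 0$, $\beta>0$ with $\alpha+\beta=1$. Put $$O_\epsilon=\{x\notin\Omega:\operatorname{dist}(x,\partial\Omega)\le\epsilon\},\quad I_\epsilon=\{x\in\Omega:\operatorname{dist}(x,\partial\Omega)\le\epsilon\},\quad \Gamma_\epsilon=O_\epsilon\cup I_\epsilon,\quad \Omega_\epsilon=\Omega\cup O_\epsilon,$$ and let $\delta=0$ on $\Omega\setminus I_\epsilon$, $\delta(x)=1-\epsilon^{-1}\operatorname{dist}(x,\partial\Omega)$ on $I_\epsilon$, $\delta=1$ on $O_\epsilon$. Let $F:\Gamma_\epsilon\to\mathbb R$ be Lipschitz continuous. For $v\in\partial B_\epsilon=\{v:|v|=\epsilon\}$ let $\mu_v$ be the uniform $(n-1)$-dimensional probability measure on the closed disk $\{z:\langle z,v\rangle=0,\ |z|\le\epsilon\}$. For a function $u$ on $\Omega_\epsilon$ put $$Iu(x)=\frac{1-\delta(x)}2\Big[\sup_{v\in\partial B_\epsilon}\Big(\alpha u(x+v)+\beta\int u(x+z)\,d\mu_v(z)\Big)+\inf_{v\in\partial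 B_\epsilon}\Big(\alpha u(x+v)+\beta\int u(x+z)\,d\mu_v(z)\Big)\Big]+\delta(x)F(x).$$ The dynamic programming principle (DPP) is the equation $u=Iu$ on $\Omega_\epsilon$. Consider the following two-player zero-sum game. A token starts at $x_0\in\Omega_\epsilon$. Whenever the token is at a point $x_k$ (including $k=0$), the game ends there with probability $\delta(x_k)$. If it does not end, Players I and II declare vectors $v^{\mathrm I},v^{\mathrm{II}}\in\partial B_\epsilon$, a fair coin selects one of them, say $v$, and the token moves to $x_{k+1}=x_k+v$ with probability $\alpha$ and to $x_{k+1}=x_k+z$, with $z$ distributed according to $\mu_v$, with probability $\beta$. A strategy is a family of Borel maps that send every history $(x_0,\dots,x_k)$ to a vector in $\partial B_\epsilon$. When the game ends at $x_\tau$, Player II pays $F(x_\tau)$ to Player I. Write $\mathbf E^{x}_{S_{\mathrm I},S_{\mathrm{II}}}$ for the expectation under the law of the game that starts at $x$ with strategies $S_{\mathrm I},S_{\mathrm{II}}$, and $$u_{\mathrm I}(x)=\sup_{S_{\mathrm I}}\inf_{S_{\mathrm{II}}}\mathbf E^{x}_{S_{\mathrm I},S_{\mathrm{II}}}[F(x_\tau)],\qquad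 u_{\mathrm{II}}(x)=\inf_{S_{\mathrm{II}}}\sup_{S_{\mathrm I}}\mathbf E^{x}_{S_{\mathrm I},S_{\mathrm{II}}}[F(x_\tau)].$$ Then: 1. For all strategies and every starting point in $\Omega_\epsilon$ the game ends almost surely in finite time, and $F(x_\tau)$ is integrable. 2. The limits $\underline u=\lim_{k\to\infty}I^k(\inf_{\Gamma_\epsilon} F)$ and $\overline u=\lim_{k\to\infty}I^k(\sup_{\Gamma_\epsilon} F)$, where $I$ is iterated starting from constant functions, exist pointwise on $\Omega_\epsilon$. They are respectively a lower semicontinuous and an upper semicontinuous solution of the DPP. 3. On $\Omega_\epsilon$ one has $u_{\mathrm{II}}\le\underline u\le\overline u\le u_{\mathrm I}\le u_{\mathrm{II}}$. 4. The DPP has a solution $u$ that is continuous on $\Omega_\epsilon$, and $u=\underline u=\overline u=u_{\mathrm I}=u_{\mathrm{II}}$ on $\Omega_\epsilon$. In particular the game has a value. -/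

import Mathlib

open MeasureTheory ProbabilityTheory Metric Set Filter Topology
open scoped ENNReal

/-- The uniform `(n-1)`-dimensional probability measure `μ_v` on the closed disk of radius `ε`
centred at the origin and orthogonal to `v`: the `(n-1)`-dimensional Hausdorff measure,
restricted to the disk and normalised to total mass one. -/
noncomputable def diskMeasure {n : ℕ} (ε : ℝ) (v : EuclideanSpace ℝ (Fin n)) :
    Measure (EuclideanSpace ℝ (Fin n)) :=
  cond (Measure.hausdorffMeasure ((n : ℝ) - 1)) {z | inner ℝ v z = 0 ∧ ‖z‖ ≤ ε}

/-- The data of the tug-of-war with noise: a bounded domain `Ω` of `ℝⁿ`, a step size `ε > 0`,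
weights `α, β ≥ 0` with `α + β = 1`, and boundary data `F`, Lipschitz on the strip
`{x | dist(x, ∂Ω) ≤ ε}`.  The values of `F` outside that strip never matter. -/
structure TugOfWar (n : ℕ) where
  Ω : Set (EuclideanSpace ℝ (Fin n))
  ε : ℝ
  α : ℝ
  β : ℝ
  F : EuclideanSpace ℝ (Fin n) → ℝ
  isOpen_Ω : IsOpen Ω
  isConnected_Ω : IsConnected Ω
  isBounded_Ω : Bornology.IsBounded Ω
  ε_pos : 0 < ε
  α_nonneg : 0 ≤ α
  β_nonneg : 0 ≤ β
  α_add_β : α + β = 1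
  lipschitz_F : ∃ K, LipschitzOnWith K F {x | infDist x (frontier Ω) ≤ ε}

namespace TugOfWar

variable {n : ℕ} (G : TugOfWar n)

/-- The outside boundary strip `O_ε`. -/
def outerStrip : Set (EuclideanSpace ℝ (Fin n)) :=
  {x | x ∉ G.Ω ∧ infDist x (frontier G.Ω) ≤ G.ε}

/-- The inside boundary strip `I_ε`. -/
def innerStrip : Set (EuclideanSpace ℝ (Fin n)) :=
  {x | x ∈ G.Ω ∧ infDist x (frontier G.Ω) ≤ G.ε}

/-- The two-sided boundary strip `Γ_ε`, on which the boundary data live. -/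
def strip : Set (EuclideanSpace ℝ (Fin n)) :=
  {x | infDist x (frontier G.Ω) ≤ G.ε}

/-- The thickened domain `Ω_ε = Ω ∪ O_ε`. -/
def thickened : Set (EuclideanSpace ℝ (Fin n)) := G.Ω ∪ G.outerStrip

open Classical in
/-- The boundary cutoff `δ`: zero on `Ω \ I_ε`, `1 - dist(x, ∂Ω) / ε` on `I_ε` and one on `O_ε`. -/
noncomputable def cutoff (x : EuclideanSpace ℝ (Fin n)) : ℝ :=
  if x ∈ G.innerStrip then 1 - infDist x (frontier G.Ω) / G.ε
  else if x ∈ G.Ω then 0 else 1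

/-! ### The dynamic programming principle -/

/-- `α u(x + v) + β ∫ u(x + z) dμ_v(z)`. -/
noncomputable def moveValue (u : EuclideanSpace ℝ (Fin n) → ℝ)
    (x v : EuclideanSpace ℝ (Fin n)) : ℝ :=
  G.α * u (x + v) + G.β * ∫ z, u (x + z) ∂(diskMeasure G.ε v)

/-- The operator `I` on the right-hand side of the dynamic programming principle. -/
noncomputable def dppOp (u : EuclideanSpace ℝ (Fin n) → ℝ) (x : EuclideanSpace ℝ (Fin n)) : ℝ :=
  (1 - G.cutoff x) / 2 *
      ((⨆ v : sphere (0 : EuclideanSpace ℝ (Fin n)) G.ε, G.moveValue u x v) +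
        ⨅ v : sphere (0 : EuclideanSpace ℝ (Fin n)) G.ε, G.moveValue u x v) +
    G.cutoff x * G.F x

/-- `u` satisfies the dynamic programming principle `u = I u` on `Ω_ε`. -/
def SolvesDPP (u : EuclideanSpace ℝ (Fin n) → ℝ) : Prop :=
  ∀ x ∈ G.thickened, u x = G.dppOp u x

/-! ### The game -/

/-- A state of the game: the position of the token and a flag telling whether the game is over. -/
abbrev State (n : ℕ) : Type := EuclideanSpace ℝ (Fin n) × Bool

/-- An admissible strategy: for every `k` a Borel map from the histories `(x₀, …, x_k)` of token
positions to the sphere of admissible moves. -/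
structure Strategy where
  move : (k : ℕ) → (Finset.Iic k → EuclideanSpace ℝ (Fin n)) →
    sphere (0 : EuclideanSpace ℝ (Fin n)) G.ε
  measurable_move : ∀ k, Measurable (move k)

/-- When the token arrives at `x`, the game ends there with probability `δ(x)`. -/
noncomputable def arrivalLaw (x : EuclideanSpace ℝ (Fin n)) : Measure (State n) :=
  ENNReal.ofReal (G.cutoff x) • Measure.dirac (x, true) +
    ENNReal.ofReal (1 - G.cutoff x) • Measure.dirac (x, false)

/-- The next position of the token if it is at `x` and the move `v` is played: with probability
`α` it is `x + v`, with probability `β` it is `x + z` with `z` distributed according to `μ_v`. -/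
noncomputable def moveLaw (x v : EuclideanSpace ℝ (Fin n)) :
    Measure (EuclideanSpace ℝ (Fin n)) :=
  ENNReal.ofReal G.α • Measure.dirac (x + v) +
    ENNReal.ofReal G.β • (diskMeasure G.ε v).map (fun z => x + z)

/-- The next position of the token if it is at `x` and the players declare `v` and `w`: a fair
coin decides which of the two moves is played. -/
noncomputable def turnLaw (x v w : EuclideanSpace ℝ (Fin n)) :
    Measure (EuclideanSpace ℝ (Fin n)) :=
  (2⁻¹ : ℝ≥0∞) • G.moveLaw x v + (2⁻¹ : ℝ≥0∞) • G.moveLaw x w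

variable {G} in
/-- The law of the next state given the history of states: nothing changes once the game is
over; otherwise a turn is played and the game may end at the new position. -/
noncomputable def stepLaw (S T : G.Strategy) (k : ℕ) (h : Finset.Iic k → State n) :
    Measure (State n) :=
  if (h ⟨k, Finset.mem_Iic.2 le_rfl⟩).2 = true then
    Measure.dirac (h ⟨k, Finset.mem_Iic.2 le_rfl⟩)
  else
    (G.turnLaw (h ⟨k, Finset.mem_Iic.2 le_rfl⟩).1
      (S.move k fun i => (h i).1) (T.move k fun i => (h i).1)).bind G.arrivalLaw

/-! #### The step laws form Markov kernels -/

lemma isProbabilityMeasure_diskMeasure {ε : ℝ} (hε : 0 < ε) {v : EuclideanSpace ℝ (Fin n)}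
    (hv : v ≠ 0) : IsProbabilityMeasure (diskMeasure ε v) := by
  have hn : 1 ≤ n := by
    rcases Nat.eq_zero_or_pos n with h | h
    · subst h
      exact absurd (Subsingleton.elim v 0) hv
    · exact h
  obtain ⟨m, rfl⟩ : ∃ m, n = m + 1 := ⟨n - 1, by omega⟩
  have : Fact (Module.finrank ℝ (EuclideanSpace ℝ (Fin (m + 1))) = m + 1) := ⟨by simp⟩
  have hfr : Module.finrank ℝ (Submodule.orthogonal (Submodule.span ℝ {v})) = m :=
    Submodule.finrank_orthogonal_span_singleton hv
  set K := Submodule.orthogonal (Submodule.span ℝ {v}) with hK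
  have himg : {z : EuclideanSpace ℝ (Fin (m + 1)) | inner ℝ v z = 0 ∧ ‖z‖ ≤ ε} =
      (Subtype.val : K → _) '' closedBall (0 : K) ε := by
    ext z
    simp only [mem_ofPred_eq, mem_image, mem_closedBall, dist_zero_right, Subtype.exists]
    constructor
    · rintro ⟨h1, h2⟩
      exact ⟨z, Submodule.mem_orthogonal_singleton_iff_inner_right.2 h1, h2, rfl⟩
    · rintro ⟨z', h1, h2, rfl⟩
      exact ⟨Submodule.mem_orthogonal_singleton_iff_inner_right.1 h1, h2⟩
  have hmeas : Measure.hausdorffMeasure (((m + 1 : ℕ) : ℝ) - 1)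
      {z : EuclideanSpace ℝ (Fin (m + 1)) | inner ℝ v z = 0 ∧ ‖z‖ ≤ ε} =
      Measure.hausdorffMeasure (Module.finrank ℝ K : ℝ) (closedBall (0 : K) ε) := by
    rw [himg, isometry_subtype_coe.hausdorffMeasure_image (Or.inl (by simp)), hfr]
    simp
  have h0 : Measure.hausdorffMeasure (((m + 1 : ℕ) : ℝ) - 1)
      {z : EuclideanSpace ℝ (Fin (m + 1)) | inner ℝ v z = 0 ∧ ‖z‖ ≤ ε} ≠ 0 := by
    rw [hmeas]
    exact (measure_closedBall_pos _ _ hε).ne'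
  have h1 : Measure.hausdorffMeasure (((m + 1 : ℕ) : ℝ) - 1)
      {z : EuclideanSpace ℝ (Fin (m + 1)) | inner ℝ v z = 0 ∧ ‖z‖ ≤ ε} ≠ ⊤ := by
    rw [hmeas]
    exact measure_closedBall_lt_top.ne
  exact cond_isProbabilityMeasure_of_finite h0 h1

/-- The reflection that exchanges two vectors `v`, `w` of equal length, applied to `z`. -/
noncomputable def swapReflection (v w z : EuclideanSpace ℝ (Fin n)) : EuclideanSpace ℝ (Fin n) :=
  z - (2 * (inner ℝ (v - w) z / ‖v - w‖ ^ 2)) • (v - w)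

lemma diskMeasure_eq_map {ε : ℝ} {v w : EuclideanSpace ℝ (Fin n)} (h : ‖v‖ = ‖w‖) :
    diskMeasure ε w = (diskMeasure ε v).map (swapReflection v w) := by
  set R := (Submodule.orthogonal (Submodule.span ℝ {v - w})).reflection with hR
  have hRv : R v = w := Submodule.reflection_sub h
  have hfun : swapReflection v w = R := by
    funext z
    rw [hR, Submodule.reflection_orthogonal_apply, Submodule.reflection_singleton_apply]
    simp [swapReflection]
    module
  have hpre : R ⁻¹' {z | inner ℝ w z = 0 ∧ ‖z‖ ≤ ε} = {z | inner ℝ v z = 0 ∧ ‖z‖ ≤ ε} := by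
    ext z
    simp only [mem_preimage, mem_ofPred_eq, LinearIsometryEquiv.norm_map]
    rw [← hRv, LinearIsometryEquiv.inner_map_map]
  have hclosed : MeasurableSet {z : EuclideanSpace ℝ (Fin n) | inner ℝ w z = 0 ∧ ‖z‖ ≤ ε} :=
    ((isClosed_eq (f := fun z => inner ℝ w z) (g := fun _ => (0 : ℝ))
        (by fun_prop) (by fun_prop)).inter
      (isClosed_le (f := fun z => ‖z‖) (g := fun _ => ε) (by fun_prop) (by fun_prop))).measurableSet
  have hmp := R.toIsometryEquiv.measurePreserving_hausdorffMeasure ((n : ℝ) - 1)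
  have hmp' : MeasurePreserving R (Measure.hausdorffMeasure ((n : ℝ) - 1))
      (Measure.hausdorffMeasure ((n : ℝ) - 1)) := hmp
  rw [hfun, diskMeasure, diskMeasure, ProbabilityTheory.cond, ProbabilityTheory.cond,
    Measure.map_smul, ← hpre,
    (hmp'.restrict_preimage hclosed).map_eq, hmp'.measure_preimage hclosed.nullMeasurableSet]

lemma measurable_swapReflection (v : EuclideanSpace ℝ (Fin n)) :
    Measurable fun p : EuclideanSpace ℝ (Fin n) × EuclideanSpace ℝ (Fin n) =>
      swapReflection v p.1 p.2 := by
  unfold swapReflection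
  fun_prop

lemma measurable_diskMeasure {ε : ℝ} (hε : 0 < ε) :
    Measurable fun v : sphere (0 : EuclideanSpace ℝ (Fin n)) ε =>
      diskMeasure ε (v : EuclideanSpace ℝ (Fin n)) := by
  rcases isEmpty_or_nonempty (sphere (0 : EuclideanSpace ℝ (Fin n)) ε) with hemp | ⟨⟨v₀⟩⟩
  · exact measurable_of_empty _
  have hv₀ : (v₀ : EuclideanSpace ℝ (Fin n)) ≠ 0 := ne_of_mem_sphere v₀.2 hε.ne'
  have := isProbabilityMeasure_diskMeasure hε hv₀
  refine Measure.measurable_of_measurable_coe _ fun s hs => ?_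
  have hm : Measurable fun p : sphere (0 : EuclideanSpace ℝ (Fin n)) ε ×
      EuclideanSpace ℝ (Fin n) => swapReflection (v₀ : EuclideanSpace ℝ (Fin n)) p.1 p.2 :=
    (measurable_swapReflection (v₀ : EuclideanSpace ℝ (Fin n))).comp
      ((measurable_subtype_coe.comp measurable_fst).prodMk measurable_snd)
  have hEq : ∀ v : sphere (0 : EuclideanSpace ℝ (Fin n)) ε,
      diskMeasure ε (v : EuclideanSpace ℝ (Fin n)) s =
        diskMeasure ε (v₀ : EuclideanSpace ℝ (Fin n)) (Prod.mk v ⁻¹'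
          ((fun p : sphere (0 : EuclideanSpace ℝ (Fin n)) ε × EuclideanSpace ℝ (Fin n) =>
            swapReflection (v₀ : EuclideanSpace ℝ (Fin n)) p.1 p.2) ⁻¹' s)) := by
    intro v
    have hnorm : ‖(v₀ : EuclideanSpace ℝ (Fin n))‖ = ‖(v : EuclideanSpace ℝ (Fin n))‖ := by
      rw [mem_sphere_zero_iff_norm.1 v₀.2, mem_sphere_zero_iff_norm.1 v.2]
    have hmv : Measurable (swapReflection (v₀ : EuclideanSpace ℝ (Fin n)) v) :=
      hm.comp (measurable_prodMk_left (x := v))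
    rw [diskMeasure_eq_map hnorm, Measure.map_apply hmv hs]
    rfl
  simp_rw [hEq]
  exact measurable_measure_prodMk_left (hm hs)

lemma measurable_cutoff : Measurable G.cutoff := by
  classical
  have h1 : MeasurableSet G.Ω := G.isOpen_Ω.measurableSet
  have hd : Measurable fun x => infDist x (frontier G.Ω) := measurable_infDist
  have h2 : MeasurableSet G.innerStrip := h1.inter (hd measurableSet_Iic)
  exact Measurable.ite h2 ((hd.div_const _).const_sub _)
    (Measurable.ite h1 measurable_const measurable_const)

lemma cutoff_nonneg (x : EuclideanSpace ℝ (Fin n)) : 0 ≤ G.cutoff x := by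
  unfold cutoff
  split_ifs with h1 h2
  · have := (div_le_one G.ε_pos).2 h1.2
    linarith
  · exact le_rfl
  · exact zero_le_one

lemma cutoff_le_one (x : EuclideanSpace ℝ (Fin n)) : G.cutoff x ≤ 1 := by
  unfold cutoff
  split_ifs with h1 h2
  · have : 0 ≤ infDist x (frontier G.Ω) / G.ε := div_nonneg infDist_nonneg G.ε_pos.le
    linarith
  · exact zero_le_one
  · exact le_rfl

instance isProbabilityMeasure_arrivalLaw (x : EuclideanSpace ℝ (Fin n)) :
    IsProbabilityMeasure (G.arrivalLaw x) := by
  constructor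
  simp only [arrivalLaw, Measure.coe_add, Measure.coe_smul, Pi.add_apply, Pi.smul_apply,
    measure_univ, smul_eq_mul, mul_one]
  rw [← ENNReal.ofReal_add (G.cutoff_nonneg x) (sub_nonneg.2 (G.cutoff_le_one x))]
  simp

lemma measurable_arrivalLaw : Measurable G.arrivalLaw := by
  have hc := G.measurable_cutoff
  refine Measure.measurable_of_measurable_coe _ fun s hs => ?_
  simp only [arrivalLaw, Measure.coe_add, Measure.coe_smul, Pi.add_apply, Pi.smul_apply,
    smul_eq_mul, Measure.dirac_apply' _ hs]
  have hi : Measurable (s.indicator (1 : State n → ℝ≥0∞)) := measurable_one.indicator hs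
  exact (hc.ennreal_ofReal.mul (hi.comp (measurable_id.prodMk measurable_const))).add
    ((hc.const_sub 1).ennreal_ofReal.mul (hi.comp (measurable_id.prodMk measurable_const)))

lemma isProbabilityMeasure_moveLaw (x : EuclideanSpace ℝ (Fin n))
    (v : sphere (0 : EuclideanSpace ℝ (Fin n)) G.ε) :
    IsProbabilityMeasure (G.moveLaw x v) := by
  have := isProbabilityMeasure_diskMeasure G.ε_pos (ne_of_mem_sphere v.2 G.ε_pos.ne')
  have : IsProbabilityMeasure ((diskMeasure G.ε (v : EuclideanSpace ℝ (Fin n))).map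
      (fun z => x + z)) := Measure.isProbabilityMeasure_map (by fun_prop)
  constructor
  simp only [moveLaw, Measure.coe_add, Measure.coe_smul, Pi.add_apply, Pi.smul_apply,
    measure_univ, smul_eq_mul, mul_one]
  rw [← ENNReal.ofReal_add G.α_nonneg G.β_nonneg, G.α_add_β, ENNReal.ofReal_one]

lemma isProbabilityMeasure_turnLaw (x : EuclideanSpace ℝ (Fin n))
    (v w : sphere (0 : EuclideanSpace ℝ (Fin n)) G.ε) :
    IsProbabilityMeasure (G.turnLaw x v w) := by
  have := G.isProbabilityMeasure_moveLaw x v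
  have := G.isProbabilityMeasure_moveLaw x w
  constructor
  simp only [turnLaw, Measure.coe_add, Measure.coe_smul, Pi.add_apply, Pi.smul_apply,
    measure_univ, smul_eq_mul, mul_one]
  exact ENNReal.inv_two_add_inv_two

lemma measurable_moveLaw :
    Measurable fun p : EuclideanSpace ℝ (Fin n) × sphere (0 : EuclideanSpace ℝ (Fin n)) G.ε =>
      G.moveLaw p.1 p.2 := by
  have hK : ∀ v : sphere (0 : EuclideanSpace ℝ (Fin n)) G.ε,
      IsProbabilityMeasure (diskMeasure G.ε (v : EuclideanSpace ℝ (Fin n))) := fun v =>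
    isProbabilityMeasure_diskMeasure G.ε_pos (ne_of_mem_sphere v.2 G.ε_pos.ne')
  let κ : Kernel (EuclideanSpace ℝ (Fin n) × sphere (0 : EuclideanSpace ℝ (Fin n)) G.ε)
      (EuclideanSpace ℝ (Fin n)) :=
    ⟨fun p => diskMeasure G.ε (p.2 : EuclideanSpace ℝ (Fin n)),
      (measurable_diskMeasure G.ε_pos).comp measurable_snd⟩
  have : IsMarkovKernel κ := ⟨fun p => hK p.2⟩
  refine Measure.measurable_of_measurable_coe _ fun s hs => ?_
  have hi : Measurable (s.indicator (1 : EuclideanSpace ℝ (Fin n) → ℝ≥0∞)) :=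
    measurable_one.indicator hs
  have hadd : Measurable fun p : EuclideanSpace ℝ (Fin n) ×
      sphere (0 : EuclideanSpace ℝ (Fin n)) G.ε => p.1 + (p.2 : EuclideanSpace ℝ (Fin n)) := by
    fun_prop
  have hset : MeasurableSet {q : (EuclideanSpace ℝ (Fin n) ×
      sphere (0 : EuclideanSpace ℝ (Fin n)) G.ε) × EuclideanSpace ℝ (Fin n) |
        q.1.1 + q.2 ∈ s} := by
    have : Measurable fun q : (EuclideanSpace ℝ (Fin n) ×
      sphere (0 : EuclideanSpace ℝ (Fin n)) G.ε) × EuclideanSpace ℝ (Fin n) =>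
        q.1.1 + q.2 := by fun_prop
    exact this hs
  have hker := Kernel.measurable_kernel_prodMk_left (κ := κ) hset
  have hEq : ∀ p : EuclideanSpace ℝ (Fin n) × sphere (0 : EuclideanSpace ℝ (Fin n)) G.ε,
      ((diskMeasure G.ε (p.2 : EuclideanSpace ℝ (Fin n))).map (fun z => p.1 + z)) s =
        κ p (Prod.mk p ⁻¹' {q | q.1.1 + q.2 ∈ s}) := by
    intro p
    rw [Measure.map_apply (by fun_prop) hs]
    rfl
  simp only [moveLaw, Measure.coe_add, Measure.coe_smul, Pi.add_apply, Pi.smul_apply,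
    smul_eq_mul, Measure.dirac_apply' _ hs, hEq]
  exact ((hi.comp hadd).const_mul _).add (hker.const_mul _)

lemma measurable_turnLaw :
    Measurable fun p : EuclideanSpace ℝ (Fin n) × sphere (0 : EuclideanSpace ℝ (Fin n)) G.ε ×
        sphere (0 : EuclideanSpace ℝ (Fin n)) G.ε => G.turnLaw p.1 p.2.1 p.2.2 := by
  refine Measure.measurable_of_measurable_coe _ fun s hs => ?_
  have hm := (Measure.measurable_coe hs).comp G.measurable_moveLaw
  have h1 := hm.comp (measurable_fst.prodMk (measurable_fst.comp measurable_snd) :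
    Measurable fun p : EuclideanSpace ℝ (Fin n) × sphere (0 : EuclideanSpace ℝ (Fin n)) G.ε ×
        sphere (0 : EuclideanSpace ℝ (Fin n)) G.ε => (p.1, p.2.1))
  have h2 := hm.comp (measurable_fst.prodMk (measurable_snd.comp measurable_snd) :
    Measurable fun p : EuclideanSpace ℝ (Fin n) × sphere (0 : EuclideanSpace ℝ (Fin n)) G.ε ×
        sphere (0 : EuclideanSpace ℝ (Fin n)) G.ε => (p.1, p.2.2))
  exact (h1.const_mul _).add (h2.const_mul _)

variable {G} in
lemma measurable_stepLaw (S T : G.Strategy) (k : ℕ) : Measurable (stepLaw S T k) := by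
  have hlast : Measurable fun h : Finset.Iic k → State n => h ⟨k, Finset.mem_Iic.2 le_rfl⟩ :=
    measurable_pi_apply _
  have hpos : Measurable fun (h : Finset.Iic k → State n) (i : Finset.Iic k) => (h i).1 :=
    measurable_pi_lambda _ fun i => measurable_fst.comp (measurable_pi_apply i)
  have hS := (S.measurable_move k).comp hpos
  have hT := (T.measurable_move k).comp hpos
  have hturn := G.measurable_turnLaw.comp ((measurable_fst.comp hlast).prodMk (hS.prodMk hT))
  have hgo := (Measure.measurable_bind' G.measurable_arrivalLaw).comp hturn
  have hstay := Measure.measurable_dirac.comp hlast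
  have hover : MeasurableSet {h : Finset.Iic k → State n |
      (h ⟨k, Finset.mem_Iic.2 le_rfl⟩).2 = true} :=
    (measurable_snd.comp hlast) (measurableSet_singleton true)
  have heq : stepLaw S T k = fun h => if (h ⟨k, Finset.mem_Iic.2 le_rfl⟩).2 = true then
      (Measure.dirac ∘ fun h : Finset.Iic k → State n => h ⟨k, Finset.mem_Iic.2 le_rfl⟩) h
      else ((fun m => Measure.bind m G.arrivalLaw) ∘ ((fun p : EuclideanSpace ℝ (Fin n) ×
        sphere (0 : EuclideanSpace ℝ (Fin n)) G.ε × sphere (0 : EuclideanSpace ℝ (Fin n)) G.ε =>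
        G.turnLaw p.1 p.2.1 p.2.2) ∘ fun h : Finset.Iic k → State n =>
          ((h ⟨k, Finset.mem_Iic.2 le_rfl⟩).1, S.move k (fun i => (h i).1),
            T.move k (fun i => (h i).1)))) h := by
    funext h
    unfold stepLaw
    simp only [Function.comp_apply]
  rw [heq]
  exact Measurable.ite hover hstay hgo

variable {G} in
/-- The law of the next state, as a kernel on histories of states. -/
noncomputable def stepKernel (S T : G.Strategy) (k : ℕ) :
    Kernel (Finset.Iic k → State n) (State n) where
  toFun := stepLaw S T k
  measurable' := measurable_stepLaw S T k

instance isMarkovKernel_stepKernel (S T : G.Strategy) (k : ℕ) :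
    IsMarkovKernel (stepKernel S T k) := by
  refine ⟨fun h => ?_⟩
  change IsProbabilityMeasure (stepLaw S T k h)
  unfold stepLaw
  split_ifs
  · infer_instance
  · have := G.isProbabilityMeasure_turnLaw (h ⟨k, Finset.mem_Iic.2 le_rfl⟩).1
      (S.move k fun i => (h i).1) (T.move k fun i => (h i).1)
    exact isProbabilityMeasure_bind G.measurable_arrivalLaw.aemeasurable
      (Eventually.of_forall fun x => G.isProbabilityMeasure_arrivalLaw x)

variable {G} in
/-- The law of the game on the space of trajectories, when it starts at `x₀`, Player I uses the
strategy `S` and Player II the strategy `T`. -/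
noncomputable def gameLaw (S T : G.Strategy) (x₀ : EuclideanSpace ℝ (Fin n)) :
    Measure (ℕ → State n) :=
  Kernel.trajMeasure (X := fun _ => State n) (G.arrivalLaw x₀) (stepKernel S T)

open Classical in
/-- The payoff `F(x_τ)` of a trajectory, where `τ` is the first time at which the game is over
(and zero if it is never over). -/
noncomputable def payoff (ω : ℕ → State n) : ℝ :=
  if h : ∃ k, (ω k).2 = true then G.F (ω (Nat.find h)).1 else 0

variable {G} in
/-- The expected payoff `𝔼[F(x_τ)]`. -/
noncomputable def expectedPayoff (S T : G.Strategy) (x₀ : EuclideanSpace ℝ (Fin n)) : ℝ :=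
  ∫ ω, G.payoff ω ∂(gameLaw S T x₀)

/-- The value `u_I = sup_S inf_T 𝔼[F(x_τ)]` of the game for Player I. -/
noncomputable def valueI (x₀ : EuclideanSpace ℝ (Fin n)) : ℝ :=
  ⨆ S : G.Strategy, ⨅ T : G.Strategy, expectedPayoff S T x₀

/-- The value `u_II = inf_T sup_S 𝔼[F(x_τ)]` of the game for Player II. -/
noncomputable def valueII (x₀ : EuclideanSpace ℝ (Fin n)) : ℝ :=
  ⨅ T : G.Strategy, ⨆ S : G.Strategy, expectedPayoff S T x₀

end TugOfWar

open scoped BoundedContinuousFunction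

namespace TugOfWar

variable {n : ℕ} (G : TugOfWar n)

/-! ### The uniform measure on the disk -/

/-! The noise alone already drives the token out of the domain. Averaging `exp (c‖x‖²)` over a
centred disk multiplies it by at least `1 + cσ`, where `σ` is the second moment of the disk. This
`σ` is positive because `n ≥ 2`, and rotation invariance makes it independent of the axis. As `β >
0`, a large `c` makes every move double this function on average, whatever direction is declared.
Truncating it and subtracting it from a constant gives a bounded `φ ≥ 1` that each move out of `Ω`
shrinks on average by a fixed factor `r < 1` (`exists_decaying`).

This `φ` has two uses. The operator contracts the norm `sup |u| / φ` by `r`, so on bounded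
continuous functions it has a fixed point that attracts every orbit (`exists_fixedPoint`). The two
limits started from the infimum and the supremum of `F` therefore coincide and are continuous; no
monotone limit argument is needed. Moreover, the expectation of `φ` over the games still running
after `k` turns is at most `r ^ k * ‖φ‖`, so the game ends almost surely (`ae_gameLaw_exists_over`).

The fixed point `u` is the value by a martingale argument. A player who in turn `k` moves within `η
/ 2 ^ (k + 1)` of the optimum makes the current value a super- or submartingale up to a total error
`η`, and it converges to the payoff. Continuity of `u` makes such moves Borel selectable, so each
player can secure `u` up to `η` (`exists_strategy_expectedPayoff_le`,
`exists_strategy_le_expectedPayoff`, `value_eq`). -/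

lemma measurableSet_disk (ε : ℝ) (v : EuclideanSpace ℝ (Fin n)) :
    MeasurableSet {z : EuclideanSpace ℝ (Fin n) | inner ℝ v z = 0 ∧ ‖z‖ ≤ ε} :=
  ((isClosed_eq (f := fun z => inner ℝ v z) (g := fun _ => (0 : ℝ))
      (by fun_prop) (by fun_prop)).inter
    (isClosed_le (f := fun z => ‖z‖) (g := fun _ => ε) (by fun_prop) (by fun_prop))).measurableSet

lemma ae_norm_le_diskMeasure (ε : ℝ) (v : EuclideanSpace ℝ (Fin n)) :
    ∀ᵐ z ∂diskMeasure ε v, ‖z‖ ≤ ε := by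
  filter_upwards [ae_cond_mem (measurableSet_disk ε v)] with z hz using hz.2

lemma isProbabilityMeasure_diskMeasure_sphere {ε : ℝ} (hε : 0 < ε)
    (v : sphere (0 : EuclideanSpace ℝ (Fin n)) ε) :
    IsProbabilityMeasure (diskMeasure ε (v : EuclideanSpace ℝ (Fin n))) :=
  isProbabilityMeasure_diskMeasure hε (ne_of_mem_sphere v.2 hε.ne')

lemma map_neg_diskMeasure (ε : ℝ) (v : EuclideanSpace ℝ (Fin n)) :
    (diskMeasure ε v).map (fun z => -z) = diskMeasure ε v := by
  have hpre : (fun z : EuclideanSpace ℝ (Fin n) => -z) ⁻¹' {z | inner ℝ v z = 0 ∧ ‖z‖ ≤ ε} =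
      {z | inner ℝ v z = 0 ∧ ‖z‖ ≤ ε} := by
    ext z
    simp
  have hmp : MeasurePreserving (fun z : EuclideanSpace ℝ (Fin n) => -z)
      (Measure.hausdorffMeasure ((n : ℝ) - 1)) (Measure.hausdorffMeasure ((n : ℝ) - 1)) :=
    (IsometryEquiv.neg (EuclideanSpace ℝ (Fin n))).measurePreserving_hausdorffMeasure ((n : ℝ) - 1)
  have h := (hmp.restrict_preimage (measurableSet_disk ε v)).map_eq
  rw [hpre] at h
  rw [diskMeasure, ProbabilityTheory.cond, Measure.map_smul, h]

lemma integral_comp_neg_diskMeasure (ε : ℝ) (v : EuclideanSpace ℝ (Fin n))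
    {f : EuclideanSpace ℝ (Fin n) → ℝ} (hf : Continuous f) :
    ∫ z, f (-z) ∂diskMeasure ε v = ∫ z, f z ∂diskMeasure ε v := by
  conv_rhs => rw [← map_neg_diskMeasure]
  rw [integral_map (by fun_prop) hf.aestronglyMeasurable]

lemma integral_diskMeasure_eq {ε : ℝ} {v w : EuclideanSpace ℝ (Fin n)} (h : ‖v‖ = ‖w‖)
    {f : EuclideanSpace ℝ (Fin n) → ℝ} (hf : Continuous f) :
    ∫ z, f z ∂diskMeasure ε w = ∫ z, f (swapReflection v w z) ∂diskMeasure ε v := by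
  have hm : Measurable (swapReflection v w) :=
    (measurable_swapReflection v).comp (measurable_prodMk_left (x := w))
  rw [diskMeasure_eq_map h, integral_map hm.aemeasurable hf.aestronglyMeasurable]

lemma norm_swapReflection (v w z : EuclideanSpace ℝ (Fin n)) :
    ‖swapReflection v w z‖ = ‖z‖ := by
  have hfun : swapReflection v w z =
      (Submodule.orthogonal (Submodule.span ℝ {v - w})).reflection z := by
    rw [Submodule.reflection_orthogonal_apply, Submodule.reflection_singleton_apply]
    simp [swapReflection]
    module
  rw [hfun, LinearIsometryEquiv.norm_map]

/-- Averages over the disk depend continuously on the base point and on the axis. -/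
lemma continuous_integral_diskMeasure {ε : ℝ} (hε : 0 < ε)
    {u : EuclideanSpace ℝ (Fin n) → ℝ} (hu : Continuous u) {C : ℝ} (hC : ∀ x, |u x| ≤ C) :
    Continuous fun p : EuclideanSpace ℝ (Fin n) × sphere (0 : EuclideanSpace ℝ (Fin n)) ε =>
      ∫ z, u (p.1 + z) ∂diskMeasure ε (p.2 : EuclideanSpace ℝ (Fin n)) := by
  rw [continuous_iff_continuousAt]
  rintro ⟨x, v⟩
  -- All disks near that of `v` are written as reflected images of one fixed disk, which puts the
  -- axis dependence into the integrand. The reflection from `b` to `w` divides by `‖b - w‖ ^ 2`, so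
  -- the base axis must stay away from `v`; the antipode does.
  set b : EuclideanSpace ℝ (Fin n) := -v with hb
  have hnorm : ∀ w : sphere (0 : EuclideanSpace ℝ (Fin n)) ε, ‖w.1‖ = ε :=
    fun w => mem_sphere_zero_iff_norm.1 w.2
  have hbv : b - v.1 ≠ 0 := by
    have hv : v.1 ≠ 0 := ne_of_mem_sphere v.2 hε.ne'
    rw [hb, show -v.1 - v.1 = (-2 : ℝ) • v.1 by module]
    exact smul_ne_zero (by norm_num) hv
  have hprob : IsProbabilityMeasure (diskMeasure ε b) := by
    refine isProbabilityMeasure_diskMeasure hε ?_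
    rw [hb, neg_ne_zero]
    exact ne_of_mem_sphere v.2 hε.ne'
  have heq : (fun p : EuclideanSpace ℝ (Fin n) × sphere (0 : EuclideanSpace ℝ (Fin n)) ε =>
      ∫ z, u (p.1 + z) ∂diskMeasure ε (p.2 : EuclideanSpace ℝ (Fin n))) =
      fun p => ∫ z, u (p.1 + swapReflection b p.2 z) ∂diskMeasure ε b := by
    funext p
    exact integral_diskMeasure_eq (f := fun z => u (p.1 + z))
      (by rw [hb, norm_neg, hnorm, hnorm]) (by fun_prop)
  rw [heq]
  refine continuousAt_of_dominated (bound := fun _ => C) ?_ ?_ (integrable_const C) ?_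
  · refine Eventually.of_forall fun p => ?_
    have hm : Measurable (swapReflection b p.2) :=
      (measurable_swapReflection b).comp (measurable_prodMk_left (x := p.2.1))
    exact (hu.measurable.comp (hm.const_add p.1)).aestronglyMeasurable
  · exact Eventually.of_forall fun p => Eventually.of_forall fun z => hC _
  · refine Eventually.of_forall fun z => ?_
    have hne : ‖b - v.1‖ ^ 2 ≠ 0 := pow_ne_zero 2 (norm_ne_zero_iff.2 hbv)
    have hq : ContinuousAt (fun p : EuclideanSpace ℝ (Fin n) ×
        sphere (0 : EuclideanSpace ℝ (Fin n)) ε =>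
          inner ℝ (b - p.2.1) z / ‖b - p.2.1‖ ^ 2) (x, v) :=
      ContinuousAt.div (by fun_prop) (by fun_prop) hne
    have hr : ContinuousAt (fun p : EuclideanSpace ℝ (Fin n) ×
        sphere (0 : EuclideanSpace ℝ (Fin n)) ε => p.1 + swapReflection b p.2 z) (x, v) := by
      unfold swapReflection
      fun_prop
    exact hu.continuousAt.comp hr

/-- The second moment of the disk measures is positive and does not depend on the axis. -/
lemma exists_secondMoment (hn : 2 ≤ n) {ε : ℝ} (hε : 0 < ε) :
    ∃ σ : ℝ, 0 < σ ∧ ∀ v : sphere (0 : EuclideanSpace ℝ (Fin n)) ε,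
      ∫ z, ‖z‖ ^ 2 ∂diskMeasure ε (v : EuclideanSpace ℝ (Fin n)) = σ := by
  have : Nontrivial (EuclideanSpace ℝ (Fin n)) := by
    have : Nontrivial (Fin n) := Fin.nontrivial_iff_two_le.2 hn
    have : Nonempty (Fin n) := inferInstance
    infer_instance
  obtain ⟨v₀, hv₀⟩ : (sphere (0 : EuclideanSpace ℝ (Fin n)) ε).Nonempty :=
    NormedSpace.sphere_nonempty.2 hε.le
  refine ⟨∫ z, ‖z‖ ^ 2 ∂diskMeasure ε v₀, ?_, fun v => ?_⟩
  · have := isProbabilityMeasure_diskMeasure_sphere hε ⟨v₀, hv₀⟩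
    have hint : Integrable (fun z => ‖z‖ ^ 2) (diskMeasure ε v₀) := by
      refine Integrable.of_bound (by fun_prop) (ε ^ 2) ?_
      filter_upwards [ae_norm_le_diskMeasure ε v₀] with z hz
      rw [Real.norm_of_nonneg (by positivity)]
      gcongr
    rw [integral_pos_iff_support_of_nonneg (fun z => by positivity) hint]
    have hsupp : Function.support (fun z : EuclideanSpace ℝ (Fin n) => ‖z‖ ^ 2) = {0}ᶜ := by
      ext z
      simp
    -- Here `n ≥ 2` is essential: Hausdorff measure of positive dimension has no atoms, whereas for
    -- `n = 1` the disk is the single point `0`.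
    have hat : diskMeasure ε v₀ {0} = 0 := by
      have hd : (0 : ℝ) < (n : ℝ) - 1 := by
        have : (2 : ℝ) ≤ n := by exact_mod_cast hn
        linarith
      have := Measure.nullSingletonClass_hausdorff (EuclideanSpace ℝ (Fin n)) hd
      have hac : diskMeasure ε v₀ ≪ Measure.hausdorffMeasure ((n : ℝ) - 1) :=
        cond_absolutelyContinuous
      exact hac (measure_singleton 0)
    rw [hsupp, prob_compl_eq_one_sub (measurableSet_singleton 0), hat]
    simp
  · rw [integral_diskMeasure_eq (v := v₀) (w := v) (by
      rw [mem_sphere_zero_iff_norm.1 hv₀, mem_sphere_zero_iff_norm.1 v.2]) (by fun_prop)]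
    simp_rw [norm_swapReflection]

/-! ### Geometry of the domain -/

/-- The inner formula and the outer constant agree on the frontier, where the distance vanishes. -/
lemma continuous_cutoff : Continuous G.cutoff := by
  classical
  have h : G.cutoff = fun x => if x ∈ G.Ω then max 0 (1 - infDist x (frontier G.Ω) / G.ε)
      else 1 := by
    funext x
    unfold cutoff innerStrip
    by_cases hx : x ∈ G.Ω
    · by_cases hd : infDist x (frontier G.Ω) ≤ G.ε
      · have := (div_le_one G.ε_pos).2 hd
        rw [if_pos ⟨hx, hd⟩, if_pos hx, max_eq_right (by linarith)]
      · have := (one_le_div G.ε_pos).2 (not_le.1 hd).le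
        rw [if_neg fun h => hd h.2, if_pos hx, if_pos hx, max_eq_left (by linarith)]
    · rw [if_neg fun h => hx h.1, if_neg hx, if_neg hx]
  rw [h]
  have hc : Continuous fun x => infDist x (frontier G.Ω) := continuous_infDist_pt _
  refine Continuous.if (fun x hx => ?_) (by fun_prop) continuous_const
  have : infDist x (frontier G.Ω) = 0 := infDist_zero_of_mem hx
  simp [this]

lemma cutoff_of_notMem {x : EuclideanSpace ℝ (Fin n)} (hx : x ∉ G.Ω) : G.cutoff x = 1 := by
  unfold cutoff
  rw [if_neg fun h => hx h.1, if_neg hx]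

lemma mem_strip_of_cutoff_ne_zero {x : EuclideanSpace ℝ (Fin n)} (hx : x ∈ G.thickened)
    (h : G.cutoff x ≠ 0) : x ∈ G.strip := by
  rcases hx with hx | hx
  · by_contra hs
    exact h (by unfold cutoff; rw [if_neg fun h => hs h.2, if_pos hx])
  · exact hx.2

/-- A segment that leaves the open set `Ω` crosses its frontier by connectedness, and the crossing
point is within `‖z‖` of the endpoint. Hence values outside `Ω_ε` never enter the game. -/
lemma add_mem_thickened {x z : EuclideanSpace ℝ (Fin n)} (hx : x ∈ G.Ω) (hz : ‖z‖ ≤ G.ε) :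
    x + z ∈ G.thickened := by
  by_cases h : x + z ∈ G.Ω
  · exact Or.inl h
  obtain ⟨y, hy, hyf⟩ : ∃ y ∈ segment ℝ x (x + z), y ∈ frontier G.Ω := by
    by_contra! hcon
    have hnot : ∀ y ∈ segment ℝ x (x + z), y ∉ G.Ω → y ∉ closure G.Ω := fun y hy hyΩ hyc =>
      hcon y hy (by rw [G.isOpen_Ω.frontier_eq]; exact ⟨hyc, hyΩ⟩)
    obtain ⟨y, -, hyΩ, hyc⟩ := (convex_segment (𝕜 := ℝ) x (x + z)).isPreconnected G.Ω
      (closure G.Ω)ᶜ G.isOpen_Ω isClosed_closure.isOpen_compl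
      (fun y hy => or_iff_not_imp_left.2 (hnot y hy))
      ⟨x, left_mem_segment ℝ _ _, hx⟩
      ⟨x + z, right_mem_segment ℝ _ _, hnot _ (right_mem_segment ℝ _ _) h⟩
    exact hyc (subset_closure hyΩ)
  refine Or.inr ⟨h, (infDist_le_dist_of_mem hyf).trans ?_⟩
  have h1 := dist_add_dist_of_mem_segment hy
  have h2 : dist x (x + z) = ‖z‖ := by simp
  have h3 : 0 ≤ dist x y := dist_nonneg
  rw [dist_comm]
  linarith

/-- Since `infDist` to the empty set is `0`, an empty frontier would turn the strip into the whole
space; this excludes it. -/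
lemma frontier_nonempty (hn : 2 ≤ n) : (frontier G.Ω).Nonempty := by
  have : Nontrivial (EuclideanSpace ℝ (Fin n)) := by
    have : Nontrivial (Fin n) := Fin.nontrivial_iff_two_le.2 hn
    have : Nonempty (Fin n) := inferInstance
    infer_instance
  refine nonempty_frontier_iff.2 ⟨G.isConnected_Ω.nonempty, fun h => ?_⟩
  have hb := G.isBounded_Ω
  rw [h] at hb
  exact NormedSpace.unbounded_univ ℝ (EuclideanSpace ℝ (Fin n)) hb

lemma isBounded_strip (hn : 2 ≤ n) : Bornology.IsBounded G.strip := by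
  have hb : Bornology.IsBounded (frontier G.Ω) :=
    G.isBounded_Ω.closure.subset frontier_subset_closure
  refine (hb.thickening (δ := G.ε + 1)).subset fun x hx => ?_
  obtain ⟨y, hy, hxy⟩ := (infDist_lt_iff (G.frontier_nonempty hn)).1
    (lt_of_le_of_lt hx (lt_add_one G.ε))
  exact mem_thickening_iff.2 ⟨y, hy, hxy⟩

lemma isCompact_strip (hn : 2 ≤ n) : IsCompact G.strip :=
  isCompact_of_isClosed_isBounded
    (isClosed_le (continuous_infDist_pt _) continuous_const) (G.isBounded_strip hn)

lemma isBounded_thickened (hn : 2 ≤ n) : Bornology.IsBounded G.thickened :=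
  (G.isBounded_Ω.union (G.isBounded_strip hn)).subset fun _ hx => hx.imp id fun h => h.2

/-- The boundary data extend to a bounded continuous function on the whole space. -/
lemma exists_extension (hn : 2 ≤ n) : ∃ f : BoundedContinuousFunction (EuclideanSpace ℝ (Fin n)) ℝ,
    ∀ x ∈ G.strip, f x = G.F x := by
  obtain ⟨K, hK⟩ := G.lipschitz_F
  obtain ⟨g, hg, hgF⟩ := hK.extend_real
  obtain ⟨C, hC⟩ := (G.isCompact_strip hn).exists_bound_of_continuousOn hK.continuousOn
  have hgc := hg.continuous
  -- Truncating the Lipschitz extension at `±|C|` makes it bounded and changes nothing on the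
  -- compact strip.
  refine ⟨BoundedContinuousFunction.ofNormedAddCommGroup (fun x => max (-|C|) (min |C| (g x)))
    (by fun_prop) |C| fun x => ?_, fun x hx => ?_⟩
  · have := abs_nonneg C
    rw [Real.norm_eq_abs, abs_le]
    exact ⟨le_max_left _ _, max_le (by linarith) (min_le_left _ _)⟩
  · have h1 := abs_le.1 ((hC x hx).trans (le_abs_self C))
    have h2 : g x = G.F x := (hgF hx).symm
    change max (-|C|) (min |C| (g x)) = G.F x
    rw [h2, min_eq_right h1.2, max_eq_right h1.1]

end TugOfWar

/-! ### Estimates for suprema and infima of real families -/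

lemma ciSup_le_ciSup_add {ι : Type*} [Nonempty ι] {f g : ι → ℝ} {C : ℝ}
    (hg : BddAbove (range g)) (h : ∀ i, f i ≤ g i + C) : ⨆ i, f i ≤ (⨆ i, g i) + C :=
  ciSup_le fun i => (h i).trans (by linarith [le_ciSup hg i])

lemma ciInf_le_ciInf_add {ι : Type*} [Nonempty ι] {f g : ι → ℝ} {C : ℝ}
    (hf : BddBelow (range f)) (h : ∀ i, f i ≤ g i + C) : ⨅ i, f i ≤ (⨅ i, g i) + C := by
  rw [← sub_le_iff_le_add]
  exact le_ciInf fun i => by linarith [h i, ciInf_le hf i]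

/-- Over an empty index type the supremum is `0` by convention, hence `0 ≤ C`. This spares the
definition of `extendedOp` the assumption that the sphere is nonempty. -/
lemma abs_iSup_le_of_abs_le {ι : Type*} {f : ι → ℝ} {C : ℝ} (hC : 0 ≤ C) (h : ∀ i, |f i| ≤ C) :
    |⨆ i, f i| ≤ C := by
  rcases isEmpty_or_nonempty ι with _ | ⟨⟨i⟩⟩
  · simpa using hC
  · have : Nonempty ι := ⟨i⟩
    exact abs_le.2 ⟨(abs_le.1 (h i)).1.trans (le_ciSup (f := f)
      ⟨C, by rintro _ ⟨j, rfl⟩; exact (abs_le.1 (h j)).2⟩ i), ciSup_le fun j => (abs_le.1 (h j)).2⟩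

lemma abs_iInf_le_of_abs_le {ι : Type*} {f : ι → ℝ} {C : ℝ} (hC : 0 ≤ C) (h : ∀ i, |f i| ≤ C) :
    |⨅ i, f i| ≤ C := by
  rcases isEmpty_or_nonempty ι with _ | ⟨⟨i⟩⟩
  · simpa using hC
  · have : Nonempty ι := ⟨i⟩
    exact abs_le.2 ⟨le_ciInf fun j => (abs_le.1 (h j)).1, (ciInf_le (f := f)
      ⟨-C, by rintro _ ⟨j, rfl⟩; exact (abs_le.1 (h j)).1⟩ i).trans (abs_le.1 (h i)).2⟩

namespace TugOfWar

variable {n : ℕ} (G : TugOfWar n)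

/-! ### Averages of bounded continuous functions over the moves -/

lemma nonempty_sphere (hn : 2 ≤ n) : Nonempty (sphere (0 : EuclideanSpace ℝ (Fin n)) G.ε) := by
  have : Nontrivial (EuclideanSpace ℝ (Fin n)) := by
    have : Nontrivial (Fin n) := Fin.nontrivial_iff_two_le.2 hn
    have : Nonempty (Fin n) := inferInstance
    infer_instance
  exact (NormedSpace.sphere_nonempty.2 G.ε_pos.le).to_subtype

instance (v : sphere (0 : EuclideanSpace ℝ (Fin n)) G.ε) :
    IsProbabilityMeasure (diskMeasure G.ε (v : EuclideanSpace ℝ (Fin n))) :=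
  isProbabilityMeasure_diskMeasure_sphere G.ε_pos v

lemma integrable_diskMeasure_comp_add (u : EuclideanSpace ℝ (Fin n) →ᵇ ℝ)
    (x : EuclideanSpace ℝ (Fin n)) (v : sphere (0 : EuclideanSpace ℝ (Fin n)) G.ε) :
    Integrable (fun z => u (x + z)) (diskMeasure G.ε (v : EuclideanSpace ℝ (Fin n))) :=
  Integrable.of_bound (u.continuous.comp (by fun_prop)).aestronglyMeasurable ‖u‖
    (Eventually.of_forall fun z => u.norm_coe_le_norm _)

lemma moveValue_congr {u w : EuclideanSpace ℝ (Fin n) → ℝ} (h : ∀ y ∈ G.thickened, u y = w y)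
    {x : EuclideanSpace ℝ (Fin n)} (hx : x ∈ G.Ω)
    (v : sphere (0 : EuclideanSpace ℝ (Fin n)) G.ε) : G.moveValue u x v = G.moveValue w x v := by
  unfold moveValue
  rw [h _ (G.add_mem_thickened hx (mem_sphere_zero_iff_norm.1 v.2).le)]
  congr 2
  refine integral_congr_ae ?_
  filter_upwards [ae_norm_le_diskMeasure G.ε (v : EuclideanSpace ℝ (Fin n))] with z hz
  exact h _ (G.add_mem_thickened hx hz)

lemma moveValue_mono {u w : EuclideanSpace ℝ (Fin n) →ᵇ ℝ} (h : ∀ y ∈ G.thickened, u y ≤ w y)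
    {x : EuclideanSpace ℝ (Fin n)} (hx : x ∈ G.Ω)
    (v : sphere (0 : EuclideanSpace ℝ (Fin n)) G.ε) :
    G.moveValue u x v ≤ G.moveValue w x v := by
  unfold moveValue
  refine add_le_add (mul_le_mul_of_nonneg_left
    (h _ (G.add_mem_thickened hx (mem_sphere_zero_iff_norm.1 v.2).le)) G.α_nonneg)
    (mul_le_mul_of_nonneg_left ?_ G.β_nonneg)
  refine integral_mono_ae (G.integrable_diskMeasure_comp_add u x v)
    (G.integrable_diskMeasure_comp_add w x v) ?_
  filter_upwards [ae_norm_le_diskMeasure G.ε (v : EuclideanSpace ℝ (Fin n))] with z hz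
  exact h _ (G.add_mem_thickened hx hz)

lemma moveValue_add_smul (u w : EuclideanSpace ℝ (Fin n) →ᵇ ℝ) (a : ℝ)
    (x : EuclideanSpace ℝ (Fin n)) (v : sphere (0 : EuclideanSpace ℝ (Fin n)) G.ε) :
    G.moveValue (u + a • w : EuclideanSpace ℝ (Fin n) →ᵇ ℝ) x v =
      G.moveValue u x v + a * G.moveValue w x v := by
  simp only [moveValue, BoundedContinuousFunction.coe_add, BoundedContinuousFunction.coe_smul,
    Pi.add_apply, smul_eq_mul]
  rw [integral_add (G.integrable_diskMeasure_comp_add u x v)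
    ((G.integrable_diskMeasure_comp_add w x v).const_mul a), integral_const_mul]
  ring

lemma abs_moveValue_le (u : EuclideanSpace ℝ (Fin n) →ᵇ ℝ) (x : EuclideanSpace ℝ (Fin n))
    (v : sphere (0 : EuclideanSpace ℝ (Fin n)) G.ε) : |G.moveValue u x v| ≤ ‖u‖ := by
  have h1 : |∫ z, u (x + z) ∂diskMeasure G.ε (v : EuclideanSpace ℝ (Fin n))| ≤ ‖u‖ := by
    have := norm_integral_le_of_norm_le_const
      (μ := diskMeasure G.ε (v : EuclideanSpace ℝ (Fin n))) (f := fun z => u (x + z)) (C := ‖u‖)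
      (Eventually.of_forall fun z => u.norm_coe_le_norm _)
    simpa using this
  have h2 : |u (x + v)| ≤ ‖u‖ := u.norm_coe_le_norm _
  unfold moveValue
  calc _ ≤ |G.α * u (x + v)| +
        |G.β * ∫ z, u (x + z) ∂diskMeasure G.ε (v : EuclideanSpace ℝ (Fin n))| := abs_add_le _ _
    _ ≤ G.α * ‖u‖ + G.β * ‖u‖ := by
        rw [abs_mul, abs_mul, abs_of_nonneg G.α_nonneg, abs_of_nonneg G.β_nonneg]
        exact add_le_add (mul_le_mul_of_nonneg_left h2 G.α_nonneg)
          (mul_le_mul_of_nonneg_left h1 G.β_nonneg)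
    _ = ‖u‖ := by rw [← add_mul, G.α_add_β, one_mul]

lemma bddAbove_moveValue (u : EuclideanSpace ℝ (Fin n) →ᵇ ℝ) (x : EuclideanSpace ℝ (Fin n)) :
    BddAbove (range fun v : sphere (0 : EuclideanSpace ℝ (Fin n)) G.ε => G.moveValue u x v) :=
  ⟨‖u‖, by rintro _ ⟨v, rfl⟩; exact (abs_le.1 (G.abs_moveValue_le u x v)).2⟩

lemma bddBelow_moveValue (u : EuclideanSpace ℝ (Fin n) →ᵇ ℝ) (x : EuclideanSpace ℝ (Fin n)) :
    BddBelow (range fun v : sphere (0 : EuclideanSpace ℝ (Fin n)) G.ε => G.moveValue u x v) :=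
  ⟨-‖u‖, by rintro _ ⟨v, rfl⟩; exact (abs_le.1 (G.abs_moveValue_le u x v)).1⟩

lemma continuous_moveValue (u : EuclideanSpace ℝ (Fin n) →ᵇ ℝ) :
    Continuous fun p : EuclideanSpace ℝ (Fin n) × sphere (0 : EuclideanSpace ℝ (Fin n)) G.ε =>
      G.moveValue u p.1 p.2 := by
  have h := continuous_integral_diskMeasure G.ε_pos u.continuous u.norm_coe_le_norm
  unfold moveValue
  exact (continuous_const.mul (u.continuous.comp (by fun_prop))).add (continuous_const.mul h)

lemma continuous_iSup_moveValue (u : EuclideanSpace ℝ (Fin n) →ᵇ ℝ) :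
    Continuous fun x => ⨆ v : sphere (0 : EuclideanSpace ℝ (Fin n)) G.ε, G.moveValue u x v := by
  have h := (isCompact_univ (X := sphere (0 : EuclideanSpace ℝ (Fin n)) G.ε)).continuous_sSup
    (f := fun x (v : sphere (0 : EuclideanSpace ℝ (Fin n)) G.ε) => G.moveValue u x v)
    (G.continuous_moveValue u)
  simp only [image_univ] at h
  exact h

lemma continuous_iInf_moveValue (u : EuclideanSpace ℝ (Fin n) →ᵇ ℝ) :
    Continuous fun x => ⨅ v : sphere (0 : EuclideanSpace ℝ (Fin n)) G.ε, G.moveValue u x v := by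
  have h := (isCompact_univ (X := sphere (0 : EuclideanSpace ℝ (Fin n)) G.ε)).continuous_sInf
    (f := fun x (v : sphere (0 : EuclideanSpace ℝ (Fin n)) G.ε) => G.moveValue u x v)
    (G.continuous_moveValue u)
  simp only [image_univ] at h
  exact h

/-! ### A supersolution that decays at a definite rate -/

/-- The parallelogram law evaluates the mean of the two exponents, convexity of `exp` (as `2ab ≤ a²
+ b²`) compares the means, and `1 + t ≤ exp t` extracts the factor. -/
lemma two_mul_exp_mul_le {E : Type*} [NormedAddCommGroup E] [InnerProductSpace ℝ E] (c : ℝ)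
    (x z : E) : 2 * (Real.exp (c * ‖x‖ ^ 2) * (1 + c * ‖z‖ ^ 2)) ≤
      Real.exp (c * ‖x + z‖ ^ 2) + Real.exp (c * ‖x + -z‖ ^ 2) := by
  have hpar : ‖x + z‖ ^ 2 + ‖x + -z‖ ^ 2 = 2 * (‖x‖ ^ 2 + ‖z‖ ^ 2) := by
    have := parallelogram_law_with_norm ℝ x z
    rw [← sub_eq_add_neg]
    linarith
  have hab : c * ‖x + z‖ ^ 2 + c * ‖x + -z‖ ^ 2 = 2 * (c * ‖x‖ ^ 2 + c * ‖z‖ ^ 2) := by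
    linear_combination c * hpar
  have key : ∀ a b : ℝ, 2 * Real.exp ((a + b) / 2) ≤ Real.exp a + Real.exp b := by
    intro a b
    have e1 : Real.exp a = Real.exp (a / 2) ^ 2 := by rw [← Real.exp_nat_mul]; push_cast; ring_nf
    have e2 : Real.exp b = Real.exp (b / 2) ^ 2 := by rw [← Real.exp_nat_mul]; push_cast; ring_nf
    rw [add_div, Real.exp_add, e1, e2]
    linarith [two_mul_le_add_sq (Real.exp (a / 2)) (Real.exp (b / 2))]
  have h1 := key (c * ‖x + z‖ ^ 2) (c * ‖x + -z‖ ^ 2)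
  rw [hab, mul_div_cancel_left₀ _ (two_ne_zero' ℝ), Real.exp_add] at h1
  have h2 : 1 + c * ‖z‖ ^ 2 ≤ Real.exp (c * ‖z‖ ^ 2) := by
    linarith [Real.add_one_le_exp (c * ‖z‖ ^ 2)]
  have h3 := mul_le_mul_of_nonneg_left h2 (Real.exp_pos (c * ‖x‖ ^ 2)).le
  linarith

lemma integrable_diskMeasure_of_continuous (v : sphere (0 : EuclideanSpace ℝ (Fin n)) G.ε)
    {f : EuclideanSpace ℝ (Fin n) → ℝ} (hf : Continuous f) :
    Integrable f (diskMeasure G.ε (v : EuclideanSpace ℝ (Fin n))) := by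
  obtain ⟨C, hC⟩ := (isCompact_closedBall (0 : EuclideanSpace ℝ (Fin n))
    G.ε).exists_bound_of_continuousOn hf.continuousOn
  refine Integrable.of_bound hf.aestronglyMeasurable C ?_
  filter_upwards [ae_norm_le_diskMeasure G.ε v.1] with z hz
  exact hC z (by simpa using hz)

/-- The disk measure is invariant under `z ↦ -z`, so the integral equals its symmetrisation, to
which the pointwise bound `two_mul_exp_mul_le` applies. -/
lemma exp_mul_le_integral_exp (c : ℝ) {σ : ℝ}
    (v : sphere (0 : EuclideanSpace ℝ (Fin n)) G.ε)
    (hσ : ∫ z, ‖z‖ ^ 2 ∂diskMeasure G.ε (v : EuclideanSpace ℝ (Fin n)) = σ)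
    (x : EuclideanSpace ℝ (Fin n)) :
    Real.exp (c * ‖x‖ ^ 2) * (1 + c * σ) ≤
      ∫ z, Real.exp (c * ‖x + z‖ ^ 2) ∂diskMeasure G.ε (v : EuclideanSpace ℝ (Fin n)) := by
  have hsymm := integral_comp_neg_diskMeasure G.ε v.1
    (f := fun z => Real.exp (c * ‖x + z‖ ^ 2)) (by fun_prop)
  have i1 := G.integrable_diskMeasure_of_continuous v
    (f := fun z => Real.exp (c * ‖x + z‖ ^ 2)) (by fun_prop)
  have i2 := G.integrable_diskMeasure_of_continuous v
    (f := fun z => Real.exp (c * ‖x + -z‖ ^ 2)) (by fun_prop)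
  have i3 := G.integrable_diskMeasure_of_continuous v
    (f := fun z => 2 * (Real.exp (c * ‖x‖ ^ 2) * (1 + c * ‖z‖ ^ 2))) (by fun_prop)
  have i4 := G.integrable_diskMeasure_of_continuous v (f := fun z => c * ‖z‖ ^ 2) (by fun_prop)
  have hmono := integral_mono i3 (i1.add i2) (two_mul_exp_mul_le c x)
  have hr : ∫ z, ((fun z => Real.exp (c * ‖x + z‖ ^ 2)) + fun z => Real.exp (c * ‖x + -z‖ ^ 2)) z
      ∂diskMeasure G.ε (v : EuclideanSpace ℝ (Fin n)) =
      2 * ∫ z, Real.exp (c * ‖x + z‖ ^ 2) ∂diskMeasure G.ε (v : EuclideanSpace ℝ (Fin n)) := by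
    rw [integral_add' i1 i2, hsymm]
    ring
  have hl : ∫ z, 2 * (Real.exp (c * ‖x‖ ^ 2) * (1 + c * ‖z‖ ^ 2))
      ∂diskMeasure G.ε (v : EuclideanSpace ℝ (Fin n)) =
      2 * (Real.exp (c * ‖x‖ ^ 2) * (1 + c * σ)) := by
    rw [integral_const_mul, integral_const_mul, integral_add (integrable_const _) i4,
      integral_const_mul, hσ]
    simp
  rw [hr, hl] at hmono
  linarith

/-- A bounded continuous function, at least one, which every move out of a point of the domain
decreases on average by a fixed factor. -/
lemma exists_decaying (hn : 2 ≤ n) (hβ : 0 < G.β) :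
    ∃ φ : EuclideanSpace ℝ (Fin n) →ᵇ ℝ, ∃ r : ℝ, 0 ≤ r ∧ r < 1 ∧ (∀ x, 1 ≤ φ x) ∧
      ∀ x ∈ G.Ω, ∀ v : sphere (0 : EuclideanSpace ℝ (Fin n)) G.ε,
        G.moveValue φ x v ≤ r * φ x := by
  obtain ⟨σ, hσ, hσv⟩ := exists_secondMoment hn G.ε_pos
  -- This makes `β c σ = 2`, so the noise term alone at least doubles `W` and the nonnegative `α`
  -- term can be dropped.
  set c := 2 / (G.β * σ) with hc
  have hc0 : 0 < c := by positivity
  have hcσ : 2 ≤ G.β * (1 + c * σ) := by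
    have : G.β * (c * σ) = 2 := by rw [hc]; field_simp
    nlinarith
  set W : EuclideanSpace ℝ (Fin n) → ℝ := fun x => Real.exp (c * ‖x‖ ^ 2) with hW
  have hWc : Continuous W := by fun_prop
  have hW1 : ∀ x, 1 ≤ W x := fun x => Real.one_le_exp (by positivity)
  obtain ⟨R, hR⟩ := (G.isBounded_thickened hn).exists_norm_le
  set B := Real.exp (c * R ^ 2) with hB
  have hB1 : 1 ≤ B := Real.one_le_exp (by positivity)
  have hWB : ∀ x ∈ G.thickened, W x ≤ B := by
    intro x hx
    have := hR x hx
    exact Real.exp_le_exp.2 (by gcongr)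
  -- `W` is unbounded on the whole space. The cap `B` bounds it on `Ω_ε`, so truncation there
  -- changes nothing.
  let ψ : EuclideanSpace ℝ (Fin n) →ᵇ ℝ := BoundedContinuousFunction.ofNormedAddCommGroup
    (fun x => min (W x) B) (by fun_prop) B fun x => by
      rw [Real.norm_of_nonneg (le_min (by linarith [hW1 x]) (by linarith))]
      exact min_le_right _ _
  have hψ1 : ∀ x, 1 ≤ ψ x := fun x => le_min (hW1 x) hB1
  have hψB : ∀ x, ψ x ≤ B := fun x => min_le_right _ _
  have hψW : ∀ x ∈ G.thickened, ψ x = W x := fun x hx => min_eq_left (hWB x hx)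
  have hdrift : ∀ x ∈ G.Ω, ∀ v : sphere (0 : EuclideanSpace ℝ (Fin n)) G.ε,
      ψ x + 1 ≤ G.moveValue ψ x v := by
    intro x hx v
    rw [G.moveValue_congr hψW hx v, hψW x (Or.inl hx)]
    have h1 := mul_le_mul_of_nonneg_left (G.exp_mul_le_integral_exp c v (hσv v) x) hβ.le
    have h2 : 0 ≤ G.α * W (x + v) := mul_nonneg G.α_nonneg (by linarith [hW1 (x + v)])
    have h3 := mul_le_mul_of_nonneg_left hcσ (by linarith [hW1 x] : (0 : ℝ) ≤ W x)
    have h4 := hW1 x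
    simp only [hW] at h1 h2 h3 h4 ⊢
    unfold moveValue
    linarith
  -- Since `1 ≤ ψ ≤ B`, the function `2B - ψ` is at least `1` and at most `2B`. A drop by `1` is
  -- then a drop by at least the fraction `1 / (2B)`.
  set one : EuclideanSpace ℝ (Fin n) →ᵇ ℝ := BoundedContinuousFunction.const _ (2 * B) with hone
  have hφ : ∀ x, (one + (-1 : ℝ) • ψ) x = 2 * B - ψ x := fun x => by
    simp [hone, sub_eq_add_neg]
  refine ⟨one + (-1 : ℝ) • ψ, 1 - 1 / (2 * B), ?_, ?_, fun x => ?_, fun x hx v => ?_⟩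
  · rw [sub_nonneg, div_le_one (by linarith)]
    linarith
  · have : 0 < 1 / (2 * B) := by positivity
    linarith
  · rw [hφ]
    linarith [hψB x]
  · have h1 : G.moveValue one x v = 2 * B := by
      simp only [moveValue, hone, BoundedContinuousFunction.const_apply, integral_const,
        probReal_univ, smul_eq_mul, one_mul]
      rw [← add_mul, G.α_add_β, one_mul]
    rw [G.moveValue_add_smul, h1, hφ]
    have h2 := hdrift x hx v
    have h3 : 1 / (2 * B) * (2 * B - ψ x) ≤ 1 := by
      rw [div_mul_eq_mul_div, div_le_one (by linarith)]
      linarith [hψ1 x]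
    linarith

/-! ### The operator on bounded continuous functions -/

/-- The operator of the dynamic programming principle, for boundary data that are bounded and
continuous on the whole space. -/
noncomputable def extendedOp (f u : EuclideanSpace ℝ (Fin n) →ᵇ ℝ) :
    EuclideanSpace ℝ (Fin n) →ᵇ ℝ :=
  BoundedContinuousFunction.ofNormedAddCommGroup
    (fun x => (1 - G.cutoff x) / 2 *
      ((⨆ v : sphere (0 : EuclideanSpace ℝ (Fin n)) G.ε, G.moveValue u x v) +
        ⨅ v : sphere (0 : EuclideanSpace ℝ (Fin n)) G.ε, G.moveValue u x v) +
      G.cutoff x * f x)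
    (by
      have h1 := G.continuous_cutoff
      have h2 := G.continuous_iSup_moveValue u
      have h3 := G.continuous_iInf_moveValue u
      have h4 := f.continuous
      fun_prop)
    (‖u‖ + ‖f‖)
    (by
      intro x
      have h0 := G.cutoff_nonneg x
      have h1 := G.cutoff_le_one x
      have hS : |⨆ v : sphere (0 : EuclideanSpace ℝ (Fin n)) G.ε, G.moveValue u x v| ≤ ‖u‖ :=
        abs_iSup_le_of_abs_le (norm_nonneg u) (G.abs_moveValue_le u x)
      have hI : |⨅ v : sphere (0 : EuclideanSpace ℝ (Fin n)) G.ε, G.moveValue u x v| ≤ ‖u‖ :=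
        abs_iInf_le_of_abs_le (norm_nonneg u) (G.abs_moveValue_le u x)
      have hf : |f x| ≤ ‖f‖ := f.norm_coe_le_norm x
      have hSI := (abs_add_le _ _).trans (add_le_add hS hI)
      rw [Real.norm_eq_abs]
      refine (abs_add_le _ _).trans ?_
      rw [abs_mul, abs_mul, abs_of_nonneg h0, abs_of_nonneg (by linarith)]
      have e1 := mul_le_mul_of_nonneg_left hSI (by linarith : 0 ≤ (1 - G.cutoff x) / 2)
      have e2 := mul_le_mul_of_nonneg_left hf h0
      nlinarith [norm_nonneg u, norm_nonneg f])

/-- Outside `Ω` the factor `1 - δ` removes the move term; inside, no move leaves `Ω_ε`. So `x` may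
be arbitrary. -/
lemma dppOp_congr {u w : EuclideanSpace ℝ (Fin n) → ℝ} (h : ∀ y ∈ G.thickened, u y = w y)
    (x : EuclideanSpace ℝ (Fin n)) : G.dppOp u x = G.dppOp w x := by
  unfold dppOp
  by_cases hx : x ∈ G.Ω
  · simp_rw [G.moveValue_congr h hx]
  · simp [G.cutoff_of_notMem hx]

/-- Within `Ω_ε`, `f` and `F` can differ only off the strip, where the cutoff multiplying them is
zero. -/
lemma extendedOp_eq_dppOp {f : EuclideanSpace ℝ (Fin n) →ᵇ ℝ} (hf : ∀ x ∈ G.strip, f x = G.F x)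
    (u : EuclideanSpace ℝ (Fin n) →ᵇ ℝ) {x : EuclideanSpace ℝ (Fin n)} (hx : x ∈ G.thickened) :
    G.extendedOp f u x = G.dppOp u x := by
  change (_ : ℝ) + G.cutoff x * f x = _ + G.cutoff x * G.F x
  congr 1
  by_cases h : G.cutoff x = 0
  · simp [h]
  · rw [hf x (G.mem_strip_of_cutoff_ne_zero hx h)]

lemma iterate_extendedOp_eq {f : EuclideanSpace ℝ (Fin n) →ᵇ ℝ}
    (hf : ∀ x ∈ G.strip, f x = G.F x) (u : EuclideanSpace ℝ (Fin n) →ᵇ ℝ) (k : ℕ) :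
    ∀ x ∈ G.thickened, ((G.extendedOp f)^[k] u) x = (G.dppOp^[k] u) x := by
  induction k with
  | zero => intro x _; rfl
  | succ k ih =>
    intro x hx
    rw [Function.iterate_succ_apply', Function.iterate_succ_apply', G.extendedOp_eq_dppOp hf _ hx,
      G.dppOp_congr ih]

/-- One application contracts the `φ`-weighted distance by `r`: from `u ≤ w + aφ`, averaging over
any move gives the same inequality with `a r φ`. It survives both the supremum and the infimum, and
the weights `(1 - δ) / 2` add up to at most one. Outside `Ω` both functions equal `f`. -/
lemma abs_extendedOp_sub_le [Nonempty (sphere (0 : EuclideanSpace ℝ (Fin n)) G.ε)]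
    (f : EuclideanSpace ℝ (Fin n) →ᵇ ℝ) {φ : EuclideanSpace ℝ (Fin n) →ᵇ ℝ} {r : ℝ}
    (hr : 0 ≤ r) (hφ1 : ∀ x, 1 ≤ φ x)
    (hφ : ∀ x ∈ G.Ω, ∀ v : sphere (0 : EuclideanSpace ℝ (Fin n)) G.ε,
      G.moveValue φ x v ≤ r * φ x)
    {u w : EuclideanSpace ℝ (Fin n) →ᵇ ℝ} {a : ℝ} (ha : 0 ≤ a)
    (h : ∀ x, |u x - w x| ≤ a * φ x) (x : EuclideanSpace ℝ (Fin n)) :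
    |G.extendedOp f u x - G.extendedOp f w x| ≤ a * r * φ x := by
  have hbound : 0 ≤ a * r * φ x := mul_nonneg (mul_nonneg ha hr) (by linarith [hφ1 x])
  by_cases hx : x ∈ G.Ω
  · have hmove : ∀ {u w : EuclideanSpace ℝ (Fin n) →ᵇ ℝ}, (∀ x, |u x - w x| ≤ a * φ x) →
        ∀ v : sphere (0 : EuclideanSpace ℝ (Fin n)) G.ε,
          G.moveValue u x v ≤ G.moveValue w x v + a * r * φ x := by
      intro u w h v
      have h1 := G.moveValue_mono (u := u) (w := w + a • φ)
        (fun y _ => by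
          have := (abs_le.1 (h y)).2
          simp only [BoundedContinuousFunction.coe_add, BoundedContinuousFunction.coe_smul,
            Pi.add_apply, smul_eq_mul]
          linarith) hx v
      rw [G.moveValue_add_smul] at h1
      have h2 := mul_le_mul_of_nonneg_left (hφ x hx v) ha
      linarith
    have h' : ∀ x, |w x - u x| ≤ a * φ x := fun x => by rw [abs_sub_comm]; exact h x
    have s1 := ciSup_le_ciSup_add (G.bddAbove_moveValue w x) (hmove h)
    have s2 := ciSup_le_ciSup_add (G.bddAbove_moveValue u x) (hmove h')
    have i1 := ciInf_le_ciInf_add (G.bddBelow_moveValue u x) (hmove h)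
    have i2 := ciInf_le_ciInf_add (G.bddBelow_moveValue w x) (hmove h')
    have h0 := G.cutoff_nonneg x
    have h1 := G.cutoff_le_one x
    have heq : G.extendedOp f u x - G.extendedOp f w x = (1 - G.cutoff x) / 2 *
        (((⨆ v : sphere (0 : EuclideanSpace ℝ (Fin n)) G.ε, G.moveValue u x v) +
          ⨅ v : sphere (0 : EuclideanSpace ℝ (Fin n)) G.ε, G.moveValue u x v) -
        ((⨆ v : sphere (0 : EuclideanSpace ℝ (Fin n)) G.ε, G.moveValue w x v) +
          ⨅ v : sphere (0 : EuclideanSpace ℝ (Fin n)) G.ε, G.moveValue w x v)) := by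
      simp only [extendedOp, BoundedContinuousFunction.coe_ofNormedAddCommGroup]
      ring
    rw [heq, abs_mul, abs_of_nonneg (by linarith)]
    calc _ ≤ (1 - G.cutoff x) / 2 * (2 * (a * r * φ x)) := by
          refine mul_le_mul_of_nonneg_left ?_ (by linarith)
          rw [abs_le]
          constructor <;> linarith
      _ ≤ a * r * φ x := by nlinarith
  · have hc := G.cutoff_of_notMem hx
    simpa [extendedOp, hc] using hbound

/-- The contraction is iterated in the weighted norm and compared with the sup norm only at the two
ends, by `1 ≤ φ ≤ ‖φ‖`; the factor `‖φ‖` thus appears once. -/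
lemma dist_iterate_extendedOp_le [Nonempty (sphere (0 : EuclideanSpace ℝ (Fin n)) G.ε)]
    (f : EuclideanSpace ℝ (Fin n) →ᵇ ℝ) {φ : EuclideanSpace ℝ (Fin n) →ᵇ ℝ} {r : ℝ}
    (hr : 0 ≤ r) (hφ1 : ∀ x, 1 ≤ φ x)
    (hφ : ∀ x ∈ G.Ω, ∀ v : sphere (0 : EuclideanSpace ℝ (Fin n)) G.ε,
      G.moveValue φ x v ≤ r * φ x)
    (u w : EuclideanSpace ℝ (Fin n) →ᵇ ℝ) (k : ℕ) :
    dist ((G.extendedOp f)^[k] u) ((G.extendedOp f)^[k] w) ≤ r ^ k * ‖φ‖ * dist u w := by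
  have hpt : ∀ k x, |((G.extendedOp f)^[k] u) x - ((G.extendedOp f)^[k] w) x| ≤
      dist u w * r ^ k * φ x := by
    intro k
    induction k with
    | zero =>
      intro x
      have h1 : |u x - w x| ≤ dist u w :=
        BoundedContinuousFunction.dist_coe_le_dist (f := u) (g := w) x
      have h2 := mul_le_mul_of_nonneg_left (hφ1 x) (dist_nonneg (x := u) (y := w))
      simp only [Function.iterate_zero, id_eq, pow_zero, mul_one] at h2 ⊢
      linarith
    | succ k ih =>
      intro x
      rw [Function.iterate_succ_apply', Function.iterate_succ_apply', pow_succ, ← mul_assoc]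
      exact G.abs_extendedOp_sub_le f hr hφ1 hφ (by positivity) ih x
  refine (BoundedContinuousFunction.dist_le (by positivity)).2 fun x => ?_
  rw [Real.dist_eq]
  refine (hpt k x).trans ?_
  have h1 : φ x ≤ ‖φ‖ := (le_abs_self _).trans (φ.norm_coe_le_norm x)
  calc dist u w * r ^ k * φ x ≤ dist u w * r ^ k * ‖φ‖ := by gcongr
    _ = _ := by ring

/-- The operator of the dynamic programming principle has a bounded continuous fixed point, which
attracts the iterates of all constants. -/
theorem exists_fixedPoint (hn : 2 ≤ n) (hβ : 0 < G.β) :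
    ∃ f u : EuclideanSpace ℝ (Fin n) →ᵇ ℝ, (∀ x ∈ G.strip, f x = G.F x) ∧
      G.extendedOp f u = u ∧ ∀ c : ℝ, ∀ x ∈ G.thickened,
      Tendsto (fun k : ℕ => (G.dppOp^[k] fun _ => c) x) atTop (𝓝 (u x)) := by
  have := G.nonempty_sphere hn
  obtain ⟨f, hf⟩ := G.exists_extension hn
  obtain ⟨φ, r, hr0, hr1, hφ1, hφ⟩ := G.exists_decaying hn hβ
  have hlim : ∀ C : ℝ, Tendsto (fun k : ℕ => r ^ k * ‖φ‖ * C) atTop (𝓝 0) := fun C => by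
    simpa using ((tendsto_pow_atTop_nhds_zero_of_lt_one hr0 hr1).mul_const ‖φ‖).mul_const C
  -- In the sup norm the operator itself need not contract, but a high iterate does. The unique
  -- fixed point of that iterate is then fixed by the operator too.
  obtain ⟨N, hN⟩ : ∃ N : ℕ, r ^ N * ‖φ‖ < 1 := by
    have := (hlim 1).eventually (gt_mem_nhds zero_lt_one)
    simpa using this.exists
  have hK : 0 ≤ r ^ N * ‖φ‖ := by positivity
  have hcontr : ContractingWith ⟨r ^ N * ‖φ‖, hK⟩ (G.extendedOp f)^[N] :=
    ⟨by exact_mod_cast hN, LipschitzWith.of_dist_le_mul fun u w =>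
      G.dist_iterate_extendedOp_le f hr0 hφ1 hφ u w N⟩
  have hfix := hcontr.isFixedPt_fixedPoint_iterate
  set u := ContractingWith.fixedPoint (G.extendedOp f)^[N] hcontr
  refine ⟨f, u, hf, hfix.eq, fun c x hx => ?_⟩
  have hconv : Tendsto (fun k => (G.extendedOp f)^[k] (BoundedContinuousFunction.const _ c))
      atTop (𝓝 u) := by
    rw [tendsto_iff_dist_tendsto_zero]
    refine squeeze_zero (fun k => dist_nonneg) (fun k => ?_)
      (hlim (dist (BoundedContinuousFunction.const _ c) u))
    have := G.dist_iterate_extendedOp_le f hr0 hφ1 hφ (BoundedContinuousFunction.const _ c) u k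
    rwa [(hfix.iterate k).eq] at this
  have hx' := ((ContinuousEvalConst.continuous_eval_const x).tendsto u).comp hconv
  refine hx'.congr fun k => ?_
  exact G.iterate_extendedOp_eq hf (BoundedContinuousFunction.const _ c) k x hx

end TugOfWar

namespace TugOfWar

variable {n : ℕ} {G : TugOfWar n}

/-! ### The law of the game -/

instance isProbabilityMeasure_gameLaw (S T : G.Strategy) (x₀ : EuclideanSpace ℝ (Fin n)) :
    IsProbabilityMeasure (gameLaw S T x₀) := by
  unfold gameLaw
  infer_instance

lemma map_zero_gameLaw (S T : G.Strategy) (x₀ : EuclideanSpace ℝ (Fin n)) :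
    (gameLaw S T x₀).map (fun ω => ω 0) = G.arrivalLaw x₀ := by
  have h : (fun ω : ℕ → State n => ω 0) =
      (fun h : Finset.Iic 0 → State n => h ⟨0, Finset.mem_Iic.2 le_rfl⟩) ∘
        Preorder.frestrictLe (π := fun _ => State n) 0 := rfl
  rw [h, ← Measure.map_map (by fun_prop) (by fun_prop), gameLaw, Kernel.trajMeasure,
    Measure.map_comp _ _ (by fun_prop), Kernel.traj_map_frestrictLe, Kernel.partialTraj_self,
    Measure.id_comp, Measure.map_map (by fun_prop) (by fun_prop)]
  exact Measure.map_id

lemma gameLaw_compProd (S T : G.Strategy) (x₀ : EuclideanSpace ℝ (Fin n)) (k : ℕ) :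
    (gameLaw S T x₀).map (Preorder.frestrictLe (π := fun _ => State n) k) ⊗ₘ stepKernel S T k =
      (gameLaw S T x₀).map
        (fun ω => (Preorder.frestrictLe (π := fun _ => State n) k ω, ω (k + 1))) :=
  Kernel.map_frestrictLe_trajMeasure_compProd_eq_map_trajMeasure

/-- History and next state are jointly distributed as the law of the history composed with the step
kernel, so almost sure statements can be checked conditionally on the history. -/
lemma ae_gameLaw_succ {S T : G.Strategy} {x₀ : EuclideanSpace ℝ (Fin n)} {k : ℕ}
    {p : (Finset.Iic k → State n) × State n → Prop} (hp : MeasurableSet {q | p q})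
    (h : ∀ᵐ ω ∂gameLaw S T x₀, ∀ᵐ s ∂stepLaw S T k
      (Preorder.frestrictLe (π := fun _ => State n) k ω),
        p (Preorder.frestrictLe (π := fun _ => State n) k ω, s)) :
    ∀ᵐ ω ∂gameLaw S T x₀, p (Preorder.frestrictLe (π := fun _ => State n) k ω, ω (k + 1)) := by
  have hm : Measurable fun ω : ℕ → State n =>
      (Preorder.frestrictLe (π := fun _ => State n) k ω, ω (k + 1)) := by fun_prop
  have : IsProbabilityMeasure
      ((gameLaw S T x₀).map (Preorder.frestrictLe (π := fun _ => State n) k)) :=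
    Measure.isProbabilityMeasure_map (by fun_prop)
  refine ae_of_ae_map hm.aemeasurable (p := p) ?_
  rw [← gameLaw_compProd, Measure.ae_compProd_iff hp]
  refine (ae_map_iff (by fun_prop) ?_).2 h
  have := Kernel.measurable_kernel_prodMk_left (κ := stepKernel S T k) hp.compl
  exact this (measurableSet_singleton 0)

lemma integral_gameLaw_succ (S T : G.Strategy) (x₀ : EuclideanSpace ℝ (Fin n)) (k : ℕ)
    {m : State n → ℝ} (hm : Measurable m) {C : ℝ} (hC : ∀ s, |m s| ≤ C) :
    ∫ ω, m (ω (k + 1)) ∂gameLaw S T x₀ =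
      ∫ ω, ∫ s, m s ∂stepLaw S T k (Preorder.frestrictLe (π := fun _ => State n) k ω)
        ∂gameLaw S T x₀ := by
  have hpair : Measurable fun ω : ℕ → State n =>
      (Preorder.frestrictLe (π := fun _ => State n) k ω, ω (k + 1)) := by fun_prop
  have : IsProbabilityMeasure
      ((gameLaw S T x₀).map (Preorder.frestrictLe (π := fun _ => State n) k)) :=
    Measure.isProbabilityMeasure_map (by fun_prop)
  have h1 : ∫ q, m q.2 ∂((gameLaw S T x₀).map
        (fun ω => (Preorder.frestrictLe (π := fun _ => State n) k ω, ω (k + 1)))) =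
      ∫ ω, m (ω (k + 1)) ∂gameLaw S T x₀ :=
    integral_map hpair.aemeasurable (hm.comp measurable_snd).aestronglyMeasurable
  rw [← h1, ← gameLaw_compProd, Measure.integral_compProd (f := fun q => m q.2)
    (Integrable.of_bound (hm.comp measurable_snd).aestronglyMeasurable C
      (Eventually.of_forall fun q => hC q.2))]
  rw [integral_map (by fun_prop)
    (StronglyMeasurable.integral_kernel_prod_right' (f := fun q => m q.2)
      (hm.comp measurable_snd).stronglyMeasurable).aestronglyMeasurable]
  rfl

/-! ### Integrals against the one-step laws -/

lemma integral_arrivalLaw (x : EuclideanSpace ℝ (Fin n)) {m : State n → ℝ} (hm : Measurable m) :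
    ∫ s, m s ∂G.arrivalLaw x = G.cutoff x * m (x, true) + (1 - G.cutoff x) * m (x, false) := by
  have hi : ∀ s₀ : State n, ∀ c : ℝ, Integrable m (ENNReal.ofReal c • Measure.dirac s₀) :=
    fun s₀ c => (integrable_dirac' hm.stronglyMeasurable (by simp)).smul_measure
      ENNReal.ofReal_ne_top
  rw [arrivalLaw, integral_add_measure (hi _ _) (hi _ _), integral_smul_measure,
    integral_smul_measure, integral_dirac' _ _ hm.stronglyMeasurable,
    integral_dirac' _ _ hm.stronglyMeasurable, ENNReal.toReal_ofReal (G.cutoff_nonneg x),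
    ENNReal.toReal_ofReal (sub_nonneg.2 (G.cutoff_le_one x))]
  simp

lemma integral_moveLaw (u : EuclideanSpace ℝ (Fin n) →ᵇ ℝ) (x : EuclideanSpace ℝ (Fin n))
    (v : sphere (0 : EuclideanSpace ℝ (Fin n)) G.ε) :
    ∫ y, u y ∂G.moveLaw x v = G.moveValue u x v := by
  have hu := u.continuous
  have hp : IsProbabilityMeasure ((diskMeasure G.ε (v : EuclideanSpace ℝ (Fin n))).map
      (fun z => x + z)) := Measure.isProbabilityMeasure_map (by fun_prop)
  rw [moveLaw, integral_add_measure ((u.integrable _).smul_measure ENNReal.ofReal_ne_top)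
    ((u.integrable _).smul_measure ENNReal.ofReal_ne_top), integral_smul_measure,
    integral_smul_measure, integral_dirac, integral_map (by fun_prop) hu.aestronglyMeasurable,
    ENNReal.toReal_ofReal G.α_nonneg, ENNReal.toReal_ofReal G.β_nonneg]
  rfl

lemma integral_turnLaw (u : EuclideanSpace ℝ (Fin n) →ᵇ ℝ) (x : EuclideanSpace ℝ (Fin n))
    (v w : sphere (0 : EuclideanSpace ℝ (Fin n)) G.ε) :
    ∫ y, u y ∂G.turnLaw x v w = (G.moveValue u x v + G.moveValue u x w) / 2 := by
  have := G.isProbabilityMeasure_moveLaw x v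
  have := G.isProbabilityMeasure_moveLaw x w
  rw [turnLaw, integral_add_measure ((u.integrable _).smul_measure (by simp))
    ((u.integrable _).smul_measure (by simp)), integral_smul_measure,
    integral_smul_measure, integral_moveLaw, integral_moveLaw]
  simp
  ring

lemma integral_stepLaw_of_true (S T : G.Strategy) {k : ℕ} {h : Finset.Iic k → State n}
    (hh : (h ⟨k, Finset.mem_Iic.2 le_rfl⟩).2 = true) {m : State n → ℝ} (hm : Measurable m) :
    ∫ s, m s ∂stepLaw S T k h = m (h ⟨k, Finset.mem_Iic.2 le_rfl⟩) := by
  rw [stepLaw, if_pos hh, integral_dirac' _ _ hm.stronglyMeasurable]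

lemma integral_stepLaw_of_false (S T : G.Strategy) {k : ℕ} {h : Finset.Iic k → State n}
    (hh : (h ⟨k, Finset.mem_Iic.2 le_rfl⟩).2 = false) {m : State n → ℝ} (hm : Measurable m)
    {C : ℝ} (hC : ∀ s, |m s| ≤ C) :
    ∫ s, m s ∂stepLaw S T k h = ∫ y, (∫ s, m s ∂G.arrivalLaw y)
      ∂G.turnLaw (h ⟨k, Finset.mem_Iic.2 le_rfl⟩).1
        (S.move k fun i => (h i).1) (T.move k fun i => (h i).1) := by
  rw [stepLaw, if_neg (by simp [hh])]
  set μ := G.turnLaw (h ⟨k, Finset.mem_Iic.2 le_rfl⟩).1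
        (S.move k fun i => (h i).1) (T.move k fun i => (h i).1)
  have : IsProbabilityMeasure μ := G.isProbabilityMeasure_turnLaw _ _ _
  let η : Kernel (EuclideanSpace ℝ (Fin n)) (State n) := ⟨G.arrivalLaw, G.measurable_arrivalLaw⟩
  have : IsMarkovKernel η := ⟨fun x => G.isProbabilityMeasure_arrivalLaw x⟩
  have := Kernel.integral_comp (κ := Kernel.const Unit μ) (η := η) (a := ()) (f := m)
    (Integrable.of_bound hm.aestronglyMeasurable C (Eventually.of_forall hC))
  exact this

/-! ### The token stays in the thickened domain, and the game stops once it is over -/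

/-- The states that can occur: the game goes on only inside the domain and ends only in the
strip. -/
def admissible (G : TugOfWar n) : Set (State n) :=
  {s | (s.2 = true ∧ s.1 ∈ G.strip) ∨ (s.2 = false ∧ s.1 ∈ G.Ω)}

lemma measurableSet_admissible : MeasurableSet G.admissible := by
  have h1 : MeasurableSet G.strip := (isClosed_le (continuous_infDist_pt _)
    continuous_const).measurableSet
  have h2 : ∀ b : Bool, MeasurableSet {s : State n | s.2 = b} := fun b =>
    measurable_snd (measurableSet_singleton b)
  exact ((h2 true).inter (measurable_fst h1)).union
    ((h2 false).inter (measurable_fst G.isOpen_Ω.measurableSet))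

/-- Each forbidden state has weight zero: off the strip the cutoff is `0`, outside `Ω` it is `1`. -/
lemma ae_arrivalLaw_admissible {x : EuclideanSpace ℝ (Fin n)} (hx : x ∈ G.thickened) :
    ∀ᵐ s ∂G.arrivalLaw x, s ∈ G.admissible := by
  have hm := (measurableSet_admissible (G := G)).compl
  rw [ae_iff]
  change G.arrivalLaw x G.admissibleᶜ = 0
  simp only [arrivalLaw, Measure.coe_add, Measure.coe_smul, Pi.add_apply, Pi.smul_apply,
    smul_eq_mul, Measure.dirac_apply' _ hm]
  have h1 : ENNReal.ofReal (G.cutoff x) * G.admissibleᶜ.indicator 1 (x, true) = 0 := by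
    by_cases h : G.cutoff x = 0
    · simp [h]
    · have : (x, true) ∈ G.admissible := Or.inl ⟨rfl, G.mem_strip_of_cutoff_ne_zero hx h⟩
      simp [this]
  have h2 : ENNReal.ofReal (1 - G.cutoff x) * G.admissibleᶜ.indicator 1 (x, false) = 0 := by
    by_cases h : x ∈ G.Ω
    · have : (x, false) ∈ G.admissible := Or.inr ⟨rfl, h⟩
      simp [this]
    · simp [G.cutoff_of_notMem h]
  rw [h1, h2, add_zero]

lemma ae_moveLaw_thickened {x : EuclideanSpace ℝ (Fin n)} (hx : x ∈ G.Ω)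
    (v : sphere (0 : EuclideanSpace ℝ (Fin n)) G.ε) :
    ∀ᵐ y ∂G.moveLaw x v, y ∈ G.thickened := by
  have hs : MeasurableSet G.thickened := G.isOpen_Ω.measurableSet.union
    (G.isOpen_Ω.measurableSet.compl.inter
      (isClosed_le (continuous_infDist_pt _) continuous_const).measurableSet)
  rw [moveLaw, ae_add_measure_iff]
  refine ⟨Measure.ae_smul_measure ?_ _, Measure.ae_smul_measure ?_ _⟩
  · exact (ae_dirac_iff hs).2 (G.add_mem_thickened hx (mem_sphere_zero_iff_norm.1 v.2).le)
  · refine (ae_map_iff (by fun_prop) hs).2 ?_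
    filter_upwards [ae_norm_le_diskMeasure G.ε v.1] with z hz
    exact G.add_mem_thickened hx hz

lemma ae_turnLaw_thickened {x : EuclideanSpace ℝ (Fin n)} (hx : x ∈ G.Ω)
    (v w : sphere (0 : EuclideanSpace ℝ (Fin n)) G.ε) :
    ∀ᵐ y ∂G.turnLaw x v w, y ∈ G.thickened := by
  rw [turnLaw, ae_add_measure_iff]
  exact ⟨Measure.ae_smul_measure (ae_moveLaw_thickened hx v) _,
    Measure.ae_smul_measure (ae_moveLaw_thickened hx w) _⟩

lemma ae_stepLaw_admissible (S T : G.Strategy) {k : ℕ} {h : Finset.Iic k → State n}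
    (hh : h ⟨k, Finset.mem_Iic.2 le_rfl⟩ ∈ G.admissible) :
    ∀ᵐ s ∂stepLaw S T k h, s ∈ G.admissible := by
  rcases hh with ⟨h1, h2⟩ | ⟨h1, h2⟩
  · rw [stepLaw, if_pos h1]
    exact (ae_dirac_iff measurableSet_admissible).2 (Or.inl ⟨h1, h2⟩)
  · rw [stepLaw, if_neg (by simp [h1]), ae_iff]
    change Measure.bind _ _ G.admissibleᶜ = 0
    rw [Measure.bind_apply measurableSet_admissible.compl G.measurable_arrivalLaw.aemeasurable,
      lintegral_eq_zero_iff (f := fun y => G.arrivalLaw y G.admissibleᶜ)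
        ((Measure.measurable_coe measurableSet_admissible.compl).comp G.measurable_arrivalLaw)]
    filter_upwards [ae_turnLaw_thickened h2 _ _] with y hy
    exact ae_iff.1 (ae_arrivalLaw_admissible hy)

lemma ae_gameLaw_admissible (S T : G.Strategy) {x₀ : EuclideanSpace ℝ (Fin n)}
    (hx₀ : x₀ ∈ G.thickened) (k : ℕ) : ∀ᵐ ω ∂gameLaw S T x₀, ω k ∈ G.admissible := by
  induction k with
  | zero =>
    have h0 : Measurable fun ω : ℕ → State n => ω 0 := measurable_pi_apply 0
    refine ae_of_ae_map h0.aemeasurable (p := fun s => s ∈ G.admissible) ?_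
    rw [map_zero_gameLaw]
    exact ae_arrivalLaw_admissible hx₀
  | succ k ih =>
    refine ae_gameLaw_succ (p := fun q => q.2 ∈ G.admissible)
      (measurable_snd measurableSet_admissible) ?_
    filter_upwards [ih] with ω hω
    exact ae_stepLaw_admissible S T hω

lemma ae_gameLaw_frozen (S T : G.Strategy) (x₀ : EuclideanSpace ℝ (Fin n)) (k : ℕ) :
    ∀ᵐ ω ∂gameLaw S T x₀, (ω k).2 = true → ω (k + 1) = ω k := by
  have hlast : Measurable fun q : (Finset.Iic k → State n) × State n =>
      q.1 ⟨k, Finset.mem_Iic.2 le_rfl⟩ := (measurable_pi_apply _).comp measurable_fst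
  refine ae_gameLaw_succ (p := fun q => (q.1 ⟨k, Finset.mem_Iic.2 le_rfl⟩).2 = true →
    q.2 = q.1 ⟨k, Finset.mem_Iic.2 le_rfl⟩) ?_ ?_
  · have h1 : MeasurableSet {q : (Finset.Iic k → State n) × State n |
        (q.1 ⟨k, Finset.mem_Iic.2 le_rfl⟩).2 = true} :=
      (measurable_snd.comp hlast) (measurableSet_singleton true)
    have h2 : MeasurableSet {q : (Finset.Iic k → State n) × State n |
        q.2 = q.1 ⟨k, Finset.mem_Iic.2 le_rfl⟩} := measurableSet_eq_fun measurable_snd hlast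
    simp_rw [imp_iff_not_or]
    exact h1.compl.union h2
  · refine Eventually.of_forall fun ω => ?_
    by_cases h : (ω k).2 = true
    · have hs : stepLaw S T k (Preorder.frestrictLe (π := fun _ => State n) k ω) =
          Measure.dirac (ω k) := by
        rw [stepLaw]
        exact if_pos h
      rw [hs]
      exact (ae_dirac_iff (by
        simp_rw [imp_iff_not_or]
        exact (MeasurableSet.const _).union (measurableSet_singleton _))).2 fun _ => rfl
    · exact Eventually.of_forall fun s hs => absurd hs h

/-! ### Termination -/

lemma measurable_ite_snd {a b : EuclideanSpace ℝ (Fin n) → ℝ} (ha : Measurable a)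
    (hb : Measurable b) : Measurable fun s : State n => if s.2 = true then a s.1 else b s.1 :=
  Measurable.ite (measurable_snd (measurableSet_singleton true)) (ha.comp measurable_fst)
    (hb.comp measurable_fst)

/-- Stopping on arrival only replaces `φ` by zero, so the decay under both players' moves bounds the
whole step. -/
lemma integral_stepLaw_decaying_le (S T : G.Strategy) {φ : EuclideanSpace ℝ (Fin n) →ᵇ ℝ} {r : ℝ}
    (hφ1 : ∀ x, 1 ≤ φ x)
    (hφ : ∀ x ∈ G.Ω, ∀ v : sphere (0 : EuclideanSpace ℝ (Fin n)) G.ε,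
      G.moveValue φ x v ≤ r * φ x)
    {k : ℕ} {h : Finset.Iic k → State n} (hh : h ⟨k, Finset.mem_Iic.2 le_rfl⟩ ∈ G.admissible) :
    ∫ s, (if s.2 = true then 0 else φ s.1) ∂stepLaw S T k h ≤
      r * if (h ⟨k, Finset.mem_Iic.2 le_rfl⟩).2 = true then 0
        else φ (h ⟨k, Finset.mem_Iic.2 le_rfl⟩).1 := by
  have hm : Measurable fun s : State n => if s.2 = true then 0 else φ s.1 :=
    measurable_ite_snd measurable_const φ.continuous.measurable
  rcases hh with ⟨h1, h2⟩ | ⟨h1, h2⟩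
  · rw [integral_stepLaw_of_true S T h1 hm, if_pos h1, mul_zero]
  · rw [integral_stepLaw_of_false S T h1 hm (C := ‖φ‖) fun s => ?_]
    swap
    · split_ifs
      · simp
      · exact φ.norm_coe_le_norm _
    simp_rw [integral_arrivalLaw _ hm]
    set x := (h ⟨k, Finset.mem_Iic.2 le_rfl⟩).1
    set v := S.move k fun i => (h i).1
    set w := T.move k fun i => (h i).1
    have hp := G.isProbabilityMeasure_turnLaw x v w
    have hle : ∀ y, G.cutoff y * (if true = true then 0 else φ y) +
        (1 - G.cutoff y) * (if false = true then 0 else φ y) ≤ φ y := fun y => by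
      have := mul_nonneg (G.cutoff_nonneg y) (by linarith [hφ1 y] : 0 ≤ φ y)
      simp only [if_true, Bool.false_eq_true, if_false]
      linarith
    refine (integral_mono_of_nonneg (Eventually.of_forall fun y => ?_) (φ.integrable _)
      (Eventually.of_forall hle)).trans ?_
    · have := mul_nonneg (sub_nonneg.2 (G.cutoff_le_one y)) (by linarith [hφ1 y] : 0 ≤ φ y)
      simpa using this
    · rw [integral_turnLaw, if_neg (by simp [h1])]
      linarith [hφ x h2 v, hφ x h2 w]

/-- Whatever the players do, the game ends almost surely. -/
theorem ae_gameLaw_exists_over (hn : 2 ≤ n) (hβ : 0 < G.β) (S T : G.Strategy)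
    {x₀ : EuclideanSpace ℝ (Fin n)} (hx₀ : x₀ ∈ G.thickened) :
    ∀ᵐ ω ∂gameLaw S T x₀, ∃ k, (ω k).2 = true := by
  obtain ⟨φ, r, hr0, hr1, hφ1, hφ⟩ := G.exists_decaying hn hβ
  set m : State n → ℝ := fun s => if s.2 = true then 0 else φ s.1 with hm_def
  have hm : Measurable m := measurable_ite_snd measurable_const φ.continuous.measurable
  have hmC : ∀ s, |m s| ≤ ‖φ‖ := fun s => by
    simp only [hm_def]
    split_ifs
    · simp
    · exact φ.norm_coe_le_norm _
  have hmω : ∀ k, Measurable fun ω : ℕ → State n => m (ω k) := fun k =>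
    hm.comp (measurable_pi_apply k)
  have hint : ∀ k, Integrable (fun ω => m (ω k)) (gameLaw S T x₀) := fun k =>
    Integrable.of_bound (hmω k).aestronglyMeasurable ‖φ‖ (Eventually.of_forall fun ω => hmC _)
  have hdecay : ∀ k, ∫ ω, m (ω k) ∂gameLaw S T x₀ ≤ r ^ k * ‖φ‖ := by
    intro k
    induction k with
    | zero =>
      have := integral_mono (hint 0) (integrable_const ‖φ‖) fun ω => (le_abs_self _).trans (hmC _)
      simpa using this
    | succ k ih =>
      rw [integral_gameLaw_succ S T x₀ k hm hmC]
      calc _ ≤ ∫ ω, r * m (ω k) ∂gameLaw S T x₀ := by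
            refine integral_mono_of_nonneg (Eventually.of_forall fun ω => ?_)
              ((hint k).const_mul r) ?_
            · refine integral_nonneg fun s => ?_
              simp only [hm_def]
              split_ifs
              · exact le_rfl
              · exact zero_le_one.trans (hφ1 s.1)
            · filter_upwards [ae_gameLaw_admissible S T hx₀ k] with ω hω
              exact integral_stepLaw_decaying_le S T hφ1 hφ hω
        _ = r * ∫ ω, m (ω k) ∂gameLaw S T x₀ := integral_const_mul _ _
        _ ≤ r * (r ^ k * ‖φ‖) := mul_le_mul_of_nonneg_left ih hr0
        _ = _ := by ring
  -- For every `k`, the function `m (ω k)` is nonnegative, and at least one on trajectories that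
  -- never end, so it dominates the indicator of that event.
  have hprob : ∀ k, (gameLaw S T x₀).real {ω | ¬ ∃ k, (ω k).2 = true} ≤ r ^ k * ‖φ‖ := by
    intro k
    refine le_trans ?_ (hdecay k)
    have hset : MeasurableSet {ω : ℕ → State n | ¬ ∃ k, (ω k).2 = true} := by
      have : ∀ k, MeasurableSet {ω : ℕ → State n | (ω k).2 = true} := fun k =>
        (measurable_snd.comp (measurable_pi_apply k)) (measurableSet_singleton true)
      have heq : {ω : ℕ → State n | ¬ ∃ k, (ω k).2 = true} =
          (⋃ k, {ω : ℕ → State n | (ω k).2 = true})ᶜ := by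
        ext ω
        simp
      rw [heq]
      exact (MeasurableSet.iUnion this).compl
    rw [← integral_indicator_one hset]
    refine integral_mono ((integrable_const (1 : ℝ)).indicator hset) (hint k) fun ω => ?_
    by_cases hω : ∃ k, (ω k).2 = true
    · rw [indicator_of_notMem (by simpa using hω)]
      simp only [hm_def]
      split_ifs
      · exact le_rfl
      · linarith [hφ1 (ω k).1]
    · rw [indicator_of_mem (by exact hω)]
      simp only [hm_def, Pi.one_apply]
      rw [if_neg fun h => hω ⟨k, h⟩]
      exact hφ1 _
  have hzero : (gameLaw S T x₀).real {ω | ¬ ∃ k, (ω k).2 = true} ≤ 0 := by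
    refine ge_of_tendsto' (x := atTop) (f := fun k : ℕ => r ^ k * ‖φ‖) ?_ hprob
    simpa using (tendsto_pow_atTop_nhds_zero_of_lt_one hr0 hr1).mul_const ‖φ‖
  rw [ae_iff]
  exact (measureReal_eq_zero_iff (by finiteness)).1 (le_antisymm hzero measureReal_nonneg)

/-! ### Expected payoffs -/

/-- Almost every trajectory is constant from its ending time on, and ends in the strip. So `m` is
prescribed only on finished states and remains free to encode the value of a running game. -/
lemma ae_tendsto_payoff (hn : 2 ≤ n) (hβ : 0 < G.β) (S T : G.Strategy)
    {x₀ : EuclideanSpace ℝ (Fin n)} (hx₀ : x₀ ∈ G.thickened) {m : State n → ℝ}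
    (hmF : ∀ x ∈ G.strip, m (x, true) = G.F x) :
    ∀ᵐ ω ∂gameLaw S T x₀, Tendsto (fun k => m (ω k)) atTop (𝓝 (G.payoff ω)) := by
  classical
  filter_upwards [ae_gameLaw_exists_over hn hβ S T hx₀,
    ae_all_iff.2 (ae_gameLaw_admissible S T hx₀), ae_all_iff.2 (ae_gameLaw_frozen S T x₀)]
    with ω hex hadm hfr
  have hpay : G.payoff ω = G.F (ω (Nat.find hex)).1 := by
    unfold payoff
    rw [dif_pos hex]
  set N := Nat.find hex with hN
  have hover : (ω N).2 = true := Nat.find_spec hex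
  have hconst : ∀ j, ω (N + j) = ω N := by
    intro j
    induction j with
    | zero => rfl
    | succ j ih => rw [← add_assoc, hfr (N + j) (by rw [ih]; exact hover), ih]
  have hstrip : (ω N).1 ∈ G.strip := by
    rcases hadm N with h | h
    · exact h.2
    · rw [hover] at h
      exact absurd h.1 (by simp)
  have hval : m (ω N) = G.F (ω N).1 := by
    rw [← hmF _ hstrip, ← hover]
  rw [hpay]
  refine tendsto_const_nhds.congr' ?_
  filter_upwards [eventually_ge_atTop N] with k hk
  obtain ⟨j, rfl⟩ := Nat.exists_eq_add_of_le hk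
  rw [hconst, hval]

/-- Measurability and the bound both come from writing the payoff as an almost sure limit of `f (ω
k).1`. -/
lemma integrable_payoff (hn : 2 ≤ n) (hβ : 0 < G.β) (S T : G.Strategy)
    {x₀ : EuclideanSpace ℝ (Fin n)} (hx₀ : x₀ ∈ G.thickened)
    {f : EuclideanSpace ℝ (Fin n) →ᵇ ℝ} (hf : ∀ x ∈ G.strip, f x = G.F x) :
    Integrable G.payoff (gameLaw S T x₀) ∧ |expectedPayoff S T x₀| ≤ ‖f‖ := by
  have h := ae_tendsto_payoff hn hβ S T hx₀ (m := fun s => f s.1) hf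
  have hb : ∀ᵐ ω ∂gameLaw S T x₀, ‖G.payoff ω‖ ≤ ‖f‖ := by
    filter_upwards [h] with ω hω
    exact le_of_tendsto' hω.norm fun k => f.norm_coe_le_norm _
  refine ⟨Integrable.of_bound (aestronglyMeasurable_of_tendsto_ae atTop (fun k => ?_) h) ‖f‖ hb, ?_⟩
  · have : Measurable fun ω : ℕ → State n => f (ω k).1 :=
      f.continuous.measurable.comp (measurable_fst.comp (measurable_pi_apply k))
    exact this.aestronglyMeasurable
  · have := norm_integral_le_of_norm_le_const hb
    simpa [expectedPayoff] using this

lemma tendsto_integral_expectedPayoff (hn : 2 ≤ n) (hβ : 0 < G.β) (S T : G.Strategy)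
    {x₀ : EuclideanSpace ℝ (Fin n)} (hx₀ : x₀ ∈ G.thickened) {m : State n → ℝ} (hm : Measurable m)
    {C : ℝ} (hC : ∀ s, |m s| ≤ C) (hmF : ∀ x ∈ G.strip, m (x, true) = G.F x) :
    Tendsto (fun k => ∫ ω, m (ω k) ∂gameLaw S T x₀) atTop (𝓝 (expectedPayoff S T x₀)) :=
  tendsto_integral_of_dominated_convergence (fun _ => C)
    (fun k => (hm.comp (measurable_pi_apply k)).aestronglyMeasurable) (integrable_const C)
    (fun _ => Eventually.of_forall fun _ => hC _) (ae_tendsto_payoff hn hβ S T hx₀ hmF)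

/-- If in the `k`-th turn the average of `m` over the next state exceeds the present value by at
most `e k`, then the average of `m` increases at most by the total error. -/
lemma integral_gameLaw_le_of_stepLaw_le (S T : G.Strategy) (x₀ : EuclideanSpace ℝ (Fin n))
    {m : State n → ℝ} (hm : Measurable m) {C : ℝ} (hC : ∀ s, |m s| ≤ C) {e : ℕ → ℝ}
    (he : ∀ k, 0 ≤ e k) {η : ℝ} (hsum : HasSum e η)
    (hstep : ∀ k (h : Finset.Iic k → State n), ∫ s, m s ∂stepLaw S T k h ≤
      m (h ⟨k, Finset.mem_Iic.2 le_rfl⟩) + e k) (k : ℕ) :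
    ∫ ω, m (ω k) ∂gameLaw S T x₀ ≤ ∫ s, m s ∂G.arrivalLaw x₀ + η := by
  have hint : ∀ k, Integrable (fun ω : ℕ → State n => m (ω k)) (gameLaw S T x₀) := fun k =>
    Integrable.of_bound (hm.comp (measurable_pi_apply k)).aestronglyMeasurable C
      (Eventually.of_forall fun ω => hC _)
  have h : ∀ k, ∫ ω, m (ω k) ∂gameLaw S T x₀ ≤
      ∫ s, m s ∂G.arrivalLaw x₀ + ∑ i ∈ Finset.range k, e i := by
    intro k
    induction k with
    | zero =>
      rw [← map_zero_gameLaw S T x₀, integral_map (measurable_pi_apply 0).aemeasurable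
        hm.aestronglyMeasurable]
      simp
    | succ k ih =>
      rw [integral_gameLaw_succ S T x₀ k hm hC, Finset.sum_range_succ, ← add_assoc]
      have hmeas : StronglyMeasurable fun ω : ℕ → State n =>
          ∫ s, m s ∂stepLaw S T k (Preorder.frestrictLe (π := fun _ => State n) k ω) :=
        (StronglyMeasurable.integral_kernel_prod_right' (κ := stepKernel S T k)
          (hm.comp measurable_snd).stronglyMeasurable).comp_measurable (by fun_prop)
      have hb : ∀ ω : ℕ → State n, ‖∫ s, m s ∂stepLaw S T k
          (Preorder.frestrictLe (π := fun _ => State n) k ω)‖ ≤ C := fun ω => by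
        have : IsProbabilityMeasure (stepLaw S T k
          (Preorder.frestrictLe (π := fun _ => State n) k ω)) :=
          (inferInstance : IsMarkovKernel (stepKernel S T k)).isProbabilityMeasure _
        simpa using norm_integral_le_of_norm_le_const (f := m)
          (μ := stepLaw S T k (Preorder.frestrictLe (π := fun _ => State n) k ω))
          (Eventually.of_forall hC)
      calc _ ≤ ∫ ω, (m (ω k) + e k) ∂gameLaw S T x₀ :=
            integral_mono (Integrable.of_bound hmeas.aestronglyMeasurable C
              (Eventually.of_forall hb)) ((hint k).add (integrable_const _))
              fun ω => hstep k _
        _ = ∫ ω, m (ω k) ∂gameLaw S T x₀ + e k := by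
            rw [integral_add (hint k) (integrable_const _)]
            simp
        _ ≤ _ := add_le_add_left ih _
  refine (h k).trans (add_le_add_right ?_ _)
  exact sum_le_hasSum _ (fun i _ => he i) hsum

/-! ### Nearly optimal strategies -/

/-- The strict inequality is an open condition on `y`, so some point of a dense sequence satisfies
it. Taking the first such point gives a measurable choice. -/
lemma exists_measurable_selection {X Y : Type*} [MeasurableSpace X] [TopologicalSpace Y]
    [TopologicalSpace.SeparableSpace Y] [Nonempty Y] [MeasurableSpace Y] {f : X → Y → ℝ}
    {g : X → ℝ} (hg : Measurable g) (hf : ∀ y, Measurable fun x => f x y)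
    (hc : ∀ x, Continuous (f x)) (h : ∀ x, ∃ y, f x y < g x) :
    ∃ s : X → Y, Measurable s ∧ ∀ x, f x (s x) < g x := by
  classical
  have hex : ∀ x, ∃ i : ℕ, f x (TopologicalSpace.denseSeq Y i) < g x := fun x => by
    obtain ⟨_, hy, i, rfl⟩ := (TopologicalSpace.denseRange_denseSeq Y).inter_open_nonempty _
      ((hc x).isOpen_preimage _ isOpen_Iio) (h x)
    exact ⟨i, hy⟩
  refine ⟨fun x => TopologicalSpace.denseSeq Y (Nat.find (hex x)), ?_,
    fun x => Nat.find_spec (hex x)⟩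
  exact (measurable_from_nat (f := TopologicalSpace.denseSeq Y)).comp
    (measurable_find hex fun i => measurableSet_lt (hf _) hg)

/-- The strategy that plays `s k x` in the `k`-th turn if the token is at `x`. -/
def Strategy.ofSelection (s : ℕ → EuclideanSpace ℝ (Fin n) →
    sphere (0 : EuclideanSpace ℝ (Fin n)) G.ε) (hs : ∀ k, Measurable (s k)) : G.Strategy where
  move k h := s k (h ⟨k, Finset.mem_Iic.2 le_rfl⟩)
  measurable_move k := (hs k).comp (measurable_pi_apply _)

/-- The payoff `f` if the game is over, and the value of the coming turn otherwise. -/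
noncomputable def stateValue (G : TugOfWar n) (f u : EuclideanSpace ℝ (Fin n) →ᵇ ℝ)
    (s : State n) : ℝ :=
  if s.2 = true then f s.1 else
    ((⨆ v : sphere (0 : EuclideanSpace ℝ (Fin n)) G.ε, G.moveValue u s.1 v) +
      ⨅ v : sphere (0 : EuclideanSpace ℝ (Fin n)) G.ε, G.moveValue u s.1 v) / 2

lemma measurable_stateValue (f u : EuclideanSpace ℝ (Fin n) →ᵇ ℝ) :
    Measurable (G.stateValue f u) :=
  measurable_ite_snd f.continuous.measurable
    (((G.continuous_iSup_moveValue u).add (G.continuous_iInf_moveValue u)).div_const 2).measurable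

lemma abs_stateValue_le (f u : EuclideanSpace ℝ (Fin n) →ᵇ ℝ) (s : State n) :
    |G.stateValue f u s| ≤ ‖f‖ + ‖u‖ := by
  have hf : |f s.1| ≤ ‖f‖ := f.norm_coe_le_norm _
  have h1 := abs_le.1 (abs_iSup_le_of_abs_le (norm_nonneg u) (G.abs_moveValue_le u s.1))
  have h2 := abs_le.1 (abs_iInf_le_of_abs_le (norm_nonneg u) (G.abs_moveValue_le u s.1))
  unfold stateValue
  split_ifs
  · linarith [norm_nonneg u]
  · rw [abs_le]
    constructor <;> linarith [norm_nonneg f]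

/-- This is the fixed point equation: averaging over the stopping coin turns the value of a state
into `u`. The coin is tossed on arrival, so the process to follow is `stateValue`, not `u` itself.
-/
lemma integral_arrivalLaw_stateValue {f u : EuclideanSpace ℝ (Fin n) →ᵇ ℝ}
    (hu : G.extendedOp f u = u) (x : EuclideanSpace ℝ (Fin n)) :
    ∫ s, G.stateValue f u s ∂G.arrivalLaw x = u x := by
  have h : u x = G.extendedOp f u x := by rw [hu]
  rw [integral_arrivalLaw x (measurable_stateValue f u), h]
  simp only [stateValue, extendedOp, BoundedContinuousFunction.coe_ofNormedAddCommGroup, if_true,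
    Bool.false_eq_true, if_false]
  ring

lemma integral_stepLaw_stateValue {f u : EuclideanSpace ℝ (Fin n) →ᵇ ℝ}
    (hu : G.extendedOp f u = u) (S T : G.Strategy) {k : ℕ} {h : Finset.Iic k → State n}
    (hh : (h ⟨k, Finset.mem_Iic.2 le_rfl⟩).2 = false) :
    ∫ s, G.stateValue f u s ∂stepLaw S T k h =
      (G.moveValue u (h ⟨k, Finset.mem_Iic.2 le_rfl⟩).1 (S.move k fun i => (h i).1) +
        G.moveValue u (h ⟨k, Finset.mem_Iic.2 le_rfl⟩).1 (T.move k fun i => (h i).1)) / 2 := by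
  rw [integral_stepLaw_of_false S T hh (measurable_stateValue f u) (abs_stateValue_le f u)]
  simp_rw [integral_arrivalLaw_stateValue hu]
  exact integral_turnLaw u _ _ _

/-- Player II can keep the expected payoff below any number above the fixed point. -/
lemma exists_strategy_expectedPayoff_le (hn : 2 ≤ n) (hβ : 0 < G.β)
    {f u : EuclideanSpace ℝ (Fin n) →ᵇ ℝ} (hf : ∀ x ∈ G.strip, f x = G.F x)
    (hu : G.extendedOp f u = u) {η : ℝ} (hη : 0 < η) :
    ∃ T : G.Strategy, ∀ S : G.Strategy, ∀ x₀ ∈ G.thickened,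
      expectedPayoff S T x₀ ≤ u x₀ + η := by
  have := G.nonempty_sphere hn
  have hsel : ∀ k : ℕ, ∃ s : EuclideanSpace ℝ (Fin n) →
      sphere (0 : EuclideanSpace ℝ (Fin n)) G.ε, Measurable s ∧ ∀ x, G.moveValue u x (s x) <
        -- The tolerances form a geometric series with sum `η`.
        (⨅ v : sphere (0 : EuclideanSpace ℝ (Fin n)) G.ε, G.moveValue u x v) + η / 2 / 2 ^ k := by
    intro k
    have hpos : 0 < η / 2 / 2 ^ k := by positivity
    refine exists_measurable_selection
      (f := fun x (v : sphere (0 : EuclideanSpace ℝ (Fin n)) G.ε) => G.moveValue u x v)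
      ((G.continuous_iInf_moveValue u).measurable.add_const _) (fun v => ?_) (fun x => ?_)
      fun x => exists_lt_of_ciInf_lt (lt_add_of_pos_right _ hpos)
    · exact ((G.continuous_moveValue u).comp (by fun_prop :
        Continuous fun x : EuclideanSpace ℝ (Fin n) => (x, v))).measurable
    · exact (G.continuous_moveValue u).comp (by fun_prop :
        Continuous fun v : sphere (0 : EuclideanSpace ℝ (Fin n)) G.ε => (x, v))
  choose s hs hsv using hsel
  refine ⟨Strategy.ofSelection s hs, fun S x₀ hx₀ => ?_⟩
  refine le_of_tendsto' (tendsto_integral_expectedPayoff hn hβ S _ hx₀ (m := G.stateValue f u)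
    (measurable_stateValue f u) (abs_stateValue_le f u) hf) fun k => ?_
  rw [← integral_arrivalLaw_stateValue hu x₀]
  refine integral_gameLaw_le_of_stepLaw_le S _ x₀ (measurable_stateValue f u)
    (abs_stateValue_le f u) (fun k => by positivity) (hasSum_geometric_two' η) (fun k h => ?_) k
  have hpos : 0 < η / 2 / 2 ^ k := by positivity
  by_cases hh : (h ⟨k, Finset.mem_Iic.2 le_rfl⟩).2 = true
  · rw [integral_stepLaw_of_true _ _ hh (measurable_stateValue f u)]
    linarith
  · rw [integral_stepLaw_stateValue hu S _ (by simpa using hh), stateValue, if_neg hh]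
    -- The opponent gets at most the supremum, Player II nearly the infimum, and the mean of the two
    -- is the present value.
    have h1 := le_ciSup (G.bddAbove_moveValue u (h ⟨k, Finset.mem_Iic.2 le_rfl⟩).1)
      (S.move k fun i => (h i).1)
    have h2 := hsv k (h ⟨k, Finset.mem_Iic.2 le_rfl⟩).1
    simp only [Strategy.ofSelection]
    linarith

/-- Player I can keep the expected payoff above any number below the fixed point. -/
lemma exists_strategy_le_expectedPayoff (hn : 2 ≤ n) (hβ : 0 < G.β)
    {f u : EuclideanSpace ℝ (Fin n) →ᵇ ℝ} (hf : ∀ x ∈ G.strip, f x = G.F x)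
    (hu : G.extendedOp f u = u) {η : ℝ} (hη : 0 < η) :
    ∃ S : G.Strategy, ∀ T : G.Strategy, ∀ x₀ ∈ G.thickened,
      u x₀ - η ≤ expectedPayoff S T x₀ := by
  have := G.nonempty_sphere hn
  have hsel : ∀ k : ℕ, ∃ s : EuclideanSpace ℝ (Fin n) →
      sphere (0 : EuclideanSpace ℝ (Fin n)) G.ε, Measurable s ∧ ∀ x, -G.moveValue u x (s x) <
        -(⨆ v : sphere (0 : EuclideanSpace ℝ (Fin n)) G.ε, G.moveValue u x v) +
          η / 2 / 2 ^ k := by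
    intro k
    have hpos : 0 < η / 2 / 2 ^ k := by positivity
    refine exists_measurable_selection
      (f := fun x (v : sphere (0 : EuclideanSpace ℝ (Fin n)) G.ε) => -G.moveValue u x v)
      ((G.continuous_iSup_moveValue u).measurable.neg.add_const _) (fun v => ?_) (fun x => ?_)
      fun x => ?_
    · exact ((G.continuous_moveValue u).comp (by fun_prop :
        Continuous fun x : EuclideanSpace ℝ (Fin n) => (x, v))).neg.measurable
    · exact ((G.continuous_moveValue u).comp (by fun_prop :
        Continuous fun v : sphere (0 : EuclideanSpace ℝ (Fin n)) G.ε => (x, v))).neg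
    · obtain ⟨v, hv⟩ := exists_lt_of_lt_ciSup (sub_lt_self
        (⨆ v : sphere (0 : EuclideanSpace ℝ (Fin n)) G.ε, G.moveValue u x v) hpos)
      exact ⟨v, by linarith⟩
  choose s hs hsv using hsel
  refine ⟨Strategy.ofSelection s hs, fun T x₀ hx₀ => ?_⟩
  refine ge_of_tendsto' (tendsto_integral_expectedPayoff hn hβ _ T hx₀ (m := G.stateValue f u)
    (measurable_stateValue f u) (abs_stateValue_le f u) hf) fun k => ?_
  -- The mirror image for Player I: the one-sided estimate is applied to the negated value.
  have hneg := integral_gameLaw_le_of_stepLaw_le (Strategy.ofSelection s hs) T x₀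
    (m := fun s => -G.stateValue f u s) (measurable_stateValue f u).neg
    (C := ‖f‖ + ‖u‖) (fun s => by rw [abs_neg]; exact abs_stateValue_le f u s)
    (e := fun k => η / 2 / 2 ^ k) (fun k => by positivity) (hasSum_geometric_two' η)
    (fun k h => ?_) k
  · rw [integral_neg, integral_neg, integral_arrivalLaw_stateValue hu] at hneg
    linarith
  have hpos : 0 < η / 2 / 2 ^ k := by positivity
  rw [integral_neg]
  by_cases hh : (h ⟨k, Finset.mem_Iic.2 le_rfl⟩).2 = true
  · rw [integral_stepLaw_of_true _ _ hh (measurable_stateValue f u)]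
    linarith
  · rw [integral_stepLaw_stateValue hu _ T (by simpa using hh), stateValue, if_neg hh]
    have h1 := ciInf_le (G.bddBelow_moveValue u (h ⟨k, Finset.mem_Iic.2 le_rfl⟩).1)
      (T.move k fun i => (h i).1)
    have h2 := hsv k (h ⟨k, Finset.mem_Iic.2 le_rfl⟩).1
    simp only [Strategy.ofSelection]
    linarith

/-- The game has a value, which is the fixed point of the operator. -/
theorem value_eq (hn : 2 ≤ n) (hβ : 0 < G.β) {f u : EuclideanSpace ℝ (Fin n) →ᵇ ℝ}
    (hf : ∀ x ∈ G.strip, f x = G.F x) (hu : G.extendedOp f u = u)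
    {x₀ : EuclideanSpace ℝ (Fin n)} (hx₀ : x₀ ∈ G.thickened) :
    G.valueI x₀ = u x₀ ∧ G.valueII x₀ = u x₀ := by
  have hb : ∀ S T : G.Strategy, |expectedPayoff S T x₀| ≤ ‖f‖ := fun S T =>
    (integrable_payoff hn hβ S T hx₀ hf).2
  -- Real suprema and infima carry junk values on empty or unbounded families, so nonemptiness and
  -- the bounds by `‖f‖` are recorded for each nested extremum.
  have hne : Nonempty G.Strategy :=
    ⟨(exists_strategy_expectedPayoff_le hn hβ hf hu one_pos).choose⟩
  have hbelow : ∀ S : G.Strategy, BddBelow (range fun T : G.Strategy => expectedPayoff S T x₀) :=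
    fun S => ⟨-‖f‖, by rintro _ ⟨T, rfl⟩; exact (abs_le.1 (hb S T)).1⟩
  have habove : ∀ T : G.Strategy, BddAbove (range fun S : G.Strategy => expectedPayoff S T x₀) :=
    fun T => ⟨‖f‖, by rintro _ ⟨S, rfl⟩; exact (abs_le.1 (hb S T)).2⟩
  have hI : BddAbove (range fun S : G.Strategy => ⨅ T : G.Strategy, expectedPayoff S T x₀) :=
    ⟨‖f‖, by
      rintro _ ⟨S, rfl⟩
      exact (abs_le.1 (abs_iInf_le_of_abs_le (norm_nonneg f) (hb S))).2⟩
  have hII : BddBelow (range fun T : G.Strategy => ⨆ S : G.Strategy, expectedPayoff S T x₀) :=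
    ⟨-‖f‖, by
      rintro _ ⟨T, rfl⟩
      exact (abs_le.1 (abs_iSup_le_of_abs_le (norm_nonneg f) fun S => hb S T)).1⟩
  have hle : G.valueI x₀ ≤ G.valueII x₀ := ciSup_le fun S => le_ciInf fun T =>
    (ciInf_le (hbelow S) T).trans (le_ciSup (habove T) S)
  have hlow : u x₀ ≤ G.valueI x₀ := by
    refine le_of_forall_pos_le_add fun η hη => ?_
    obtain ⟨S, hS⟩ := exists_strategy_le_expectedPayoff hn hβ hf hu hη
    have : u x₀ - η ≤ G.valueI x₀ := (le_ciInf fun T => hS T x₀ hx₀).trans (le_ciSup hI S)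
    linarith
  have hup : G.valueII x₀ ≤ u x₀ := by
    refine le_of_forall_pos_le_add fun η hη => ?_
    obtain ⟨T, hT⟩ := exists_strategy_expectedPayoff_le hn hβ hf hu hη
    exact (ciInf_le hII T).trans (ciSup_le fun S => hT S x₀ hx₀)
  exact ⟨le_antisymm (hle.trans hup) hlow, le_antisymm hup (hlow.trans hle)⟩

end TugOfWar

/-! ### The main theorem -/

theorem mainTheorem3 {n : ℕ} (hn : 2 ≤ n) (G : TugOfWar n) (hβ : 0 < G.β) :
    -- the game ends almost surely and its payoff is integrable, whatever the players do
    (∀ x ∈ G.thickened, ∀ S T : G.Strategy,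
      (∀ᵐ ω ∂(TugOfWar.gameLaw S T x), ∃ k, (ω k).2 = true) ∧
        Integrable G.payoff (TugOfWar.gameLaw S T x)) ∧
    ∃ uLow uUp u : EuclideanSpace ℝ (Fin n) → ℝ,
      -- the two monotone limits are semicontinuous solutions
      (∀ x ∈ G.thickened,
        Tendsto (fun k : ℕ => (G.dppOp^[k] fun _ => sInf (G.F '' G.strip)) x)
          atTop (𝓝 (uLow x))) ∧
      (∀ x ∈ G.thickened,
        Tendsto (fun k : ℕ => (G.dppOp^[k] fun _ => sSup (G.F '' G.strip)) x)
          atTop (𝓝 (uUp x))) ∧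
      LowerSemicontinuousOn uLow G.thickened ∧ G.SolvesDPP uLow ∧
      UpperSemicontinuousOn uUp G.thickened ∧ G.SolvesDPP uUp ∧
      -- the chain of inequalities
      (∀ x ∈ G.thickened,
        G.valueII x ≤ uLow x ∧ uLow x ≤ uUp x ∧ uUp x ≤ G.valueI x ∧
          G.valueI x ≤ G.valueII x) ∧
      -- a continuous solution, equal to the semicontinuous ones and to the value of the game
      ContinuousOn u G.thickened ∧ G.SolvesDPP u ∧
      (∀ x ∈ G.thickened,
        u x = uLow x ∧ u x = uUp x ∧ u x = G.valueI x ∧ u x = G.valueII x) := by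
  obtain ⟨f, u, hf, hu, hlim⟩ := G.exists_fixedPoint hn hβ
  have hdpp : G.SolvesDPP u := fun x hx => by rw [← G.extendedOp_eq_dppOp hf u hx, hu]
  have hval : ∀ x ∈ G.thickened, G.valueI x = u x ∧ G.valueII x = u x := fun x hx =>
    TugOfWar.value_eq hn hβ hf hu hx
  -- One function serves as all three: `hlim` holds for every starting constant, and continuity
  -- yields both semicontinuities.
  refine ⟨fun x hx S T => ⟨TugOfWar.ae_gameLaw_exists_over hn hβ S T hx,
    (TugOfWar.integrable_payoff hn hβ S T hx hf).1⟩, u, u, u, hlim _, hlim _,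
    u.continuous.lowerSemicontinuous.lowerSemicontinuousOn _, hdpp,
    u.continuous.upperSemicontinuous.upperSemicontinuousOn _, hdpp, fun x hx => ?_,
    u.continuous.continuousOn, hdpp, fun x hx => ?_⟩
  · obtain ⟨h1, h2⟩ := hval x hx
    exact ⟨h2.le, le_rfl, h1.ge, (h1.trans h2.symm).le⟩
  · obtain ⟨h1, h2⟩ := hval x hx
    exact ⟨rfl, rfl, h1.symm, h2.symm⟩
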